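/- **Setting.** There are $k\ge 1$ actions, all losses lie in $[0,1]$, and there are $T$ rounds. *Full feedback.* A full-feedback algorithm plays in round $t$ a distribution over $[k]$ that is a (measurable) function of the loss vectors of the rounds before $t$. It is *monotone* if lowering the loss of one action $i$ in one past round never lowers its probability of playing $i$. A family $(\mathrm{Alg}_N)_N$ of such algorithms ($N$ the time horizon) has *no external regret* if its worst-case regret over $N$ rounds against the best fixed action is $o(N)$. *TreeSwap* with base algorithm $\mathrm{Alg}$, branching $M$ and depth $d$ ($M^{d-1}\le T\le M^d$) works as follows. For round $t=0,\dots,T-1$ let $\sigma_1\cdots\sigma_d$ be the base-$M$ representation of $t$, and keep an instance of $\mathrm{Alg}_M$ for every word of length less than $d$ over $\{0,\dots,M-1\}$. The instance at $\sigma_1\cdots\sigma_{h-1}$ is updated only at the end of each of its periods of length $M^{d-h}$, with the average of the loss vectors of that period. In round $t$ TreeSwap plays the uniform mixture of the current distributions of the $d$ instances at $\sigma_1\cdots\sigma_{h-1}$, $1\le h\le d$. *Bandit feedback.* In round $t$ a bandit algorithm draws fresh random bits $\mathcal R^t$, independent of the past, and selects an action $s^t$ that is a deterministic function of $\mathcal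 R^t$ and of the transcript $\phi^{1:t-1}$, that is, of the random bits, selected actions and observed losses of the earlier rounds. An adaptive adversary $\ell$ chooses the loss vector $\ell(\phi^{1:t-1})\in[0,1]^k$ as a function of the transcript. The algorithm observes only the loss $\ell(\phi^{1:t-1})[s^t]$. The swap regret is $$\mathrm{SReg}(T,\ell)=\max_{\chi:[k]\to[k]}\ \mathbb E\sum_{t=1}^T\Big(\ell(\phi^{1:t-1})[s^t]-\ell(\phi^{1:t-1})[\chi(s^t)]\Big).$$ A bandit algorithm is *monotone* if the following holds: take any history of selected actions and observed losses and lower the loss observed in one round, in which, say, action $i$ was selected, changing nothing else; then the probability over the random bits that $i$ is selected in a later round does not decrease. It is *monotone in the losses* if lowering the loss of one action $i$ in one round of a fixed sequence of loss vectors does not decrease the probability that $i$ is selected in any later round. *MonoBandit* with a full-feedback algorithm $\mathcal A$ and $\varepsilon\in(0,1]$ tosses in every round an independent coin that shows "explore $i$" with probability $\varepsilon/k$ for each $i\in[k]$ and "exploit" with probability $1-\varepsilon$. On "explore $i$" it plays $i$, observes the loss $b$, and passes to $\mathcal A$ the vector that is $kb/\varepsilon$ at $i$ and $0$ elsewhere.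 (In a history in which the selected action is not the explored one, the zero vector is passed.) On "exploit" it samples its action from the current distribution of $\mathcal A$ (in the first round, from the uniform distribution) and passes the zero vector. TreeSwap is run here for losses in $[0,k/\varepsilon]$, i.e. on the losses divided by $k/\varepsilon$. **Theorem.** For every $k\ge1$ let $(\mathrm{Alg}^{(k)}_N)_N$ be a family of monotone full-feedback algorithms over $k$ actions with no external regret. For all $k$ and $T$ let $M=M(k,T)$ and $d=d(k,T)\ge 1$ satisfy $M^{d-1}\le T\le M^d$ for $T\ge 1$, with $M\to\infty$ and $d\to\infty$ as $T\to\infty$ for every $k$. Let MonoBandit(TreeSwap) be MonoBandit with $\mathcal A$ = TreeSwap with base algorithm $\mathrm{Alg}^{(k)}$, branching $M$ and depth $d$. 1. For all $k\ge1$, $T$ and $\varepsilon\in(0,1]$, MonoBandit(TreeSwap) is monotone, and also monotone in the losses. 2. There are exploration probabilities $\varepsilon(k,T)\in(0,1]$ and a function $g$ with $g(T)=o(T)$ that does not depend on $k$ such that, for all $k\ge1$, all $T$ and all adaptive adversaries $\ell$, $$\mathrm{SReg}_{\mathrm{MonoBandit(TreeSwap)}}(T,\ell)\le 2\sqrt k\cdot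 g(T).$$ Moreover, such base algorithms and parameters exist: Multiplicative Weights with learning rate $\sqrt{\log k/N}$ is monotone and has no external regret, and functions $M,d$ as above exist. Hence there is a monotone bandit algorithm with sublinear swap regret against adaptive adversaries. -/

import Mathlib

open MeasureTheory

noncomputable section

/-! ### Full-feedback learning algorithms -/

/-- A full-feedback learning algorithm over the `k` actions `Fin k`: in round `t` (rounds are
numbered from `0`) it plays a probability distribution over the actions, which is a measurable
function of the `t` loss vectors of the earlier rounds. -/
structure FullAlgorithm (k : ℕ) where
  prob : (t : ℕ) → (Fin t → Fin k → ℝ) → Fin k → ℝ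
  prob_mem : ∀ t L, prob t L ∈ stdSimplex ℝ (Fin k)
  measurable_prob : ∀ t, Measurable (prob t)

namespace FullAlgorithm

variable {k : ℕ}

/-- Monotonicity under full feedback: lowering the loss of one action `i` in one past round `s`
does not lower the probability of playing `i` now. -/
def IsMonotone (A : FullAlgorithm k) : Prop :=
  ∀ (t : ℕ) (L : Fin t → Fin k → ℝ), (∀ s a, L s a ∈ Set.Icc (0 : ℝ) 1) →
    ∀ (s : Fin t) (i : Fin k) (x : ℝ), 0 ≤ x → x ≤ L s i →
      A.prob t L i ≤ A.prob t (Function.update L s (Function.update (L s) i x)) i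

/-- Regret over `N` rounds on the losses `L` against the fixed action `i`. -/
def regret (A : FullAlgorithm k) (N : ℕ) (L : ℕ → Fin k → ℝ) (i : Fin k) : ℝ :=
  ∑ t ∈ Finset.range N, ((∑ a, A.prob t (fun s : Fin t => L s) a * L t a) - L t i)

/-- `A`, run on losses from `[0, B]`: the losses are normalized to `[0, 1]` and passed to `A`. -/
def rescale (B : ℝ) (A : FullAlgorithm k) : FullAlgorithm k where
  prob t L := A.prob t (fun s a => L s a / B)
  prob_mem _ _ := A.prob_mem _ _
  measurable_prob t := (A.measurable_prob t).comp (by fun_prop)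

end FullAlgorithm

/-- A family of full-feedback algorithms, one for every time horizon `N`, has no external regret:
its worst-case regret on losses from `[0, 1]` is `o(N)`. -/
def NoExternalRegret {k : ℕ} (A : ℕ → FullAlgorithm k) : Prop :=
  ∃ R : ℕ → ℝ, R =o[Filter.atTop] (fun N => (N : ℝ)) ∧
    ∀ (N : ℕ) (L : ℕ → Fin k → ℝ), (∀ t a, L t a ∈ Set.Icc (0 : ℝ) 1) →
      ∀ i, (A N).regret N L i ≤ R N

/-- The uniform distribution on `Fin k`. -/
def uniformDist (k : ℕ) : Fin k → ℝ := fun _ => 1 / k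

lemma uniformDist_mem (k : ℕ) [NeZero k] : uniformDist k ∈ stdSimplex ℝ (Fin k) := by
  refine ⟨fun _ => by unfold uniformDist; positivity, ?_⟩
  have : (k : ℝ) ≠ 0 := by exact_mod_cast NeZero.ne k
  simp [uniformDist, this]

/-- Multiplicative Weights with time horizon `N` and learning rate `√(log k / N)`. -/
def multiplicativeWeights (k : ℕ) [NeZero k] (N : ℕ) : FullAlgorithm k where
  prob t L i :=
    Real.exp (-Real.sqrt (Real.log k / N) * ∑ s, L s i) /
      ∑ j, Real.exp (-Real.sqrt (Real.log k / N) * ∑ s, L s j)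
  prob_mem t L := by
    refine ⟨fun i => by positivity, ?_⟩
    rw [← Finset.sum_div]
    exact div_self (Finset.sum_pos (fun j _ => Real.exp_pos _) Finset.univ_nonempty).ne'
  measurable_prob t := by fun_prop

/-! ### TreeSwap -/

/-- The loss vector of round `s` in a history of length `t` (`0` if the round is not in it). -/
def pastLoss {k t : ℕ} (L : Fin t → Fin k → ℝ) (s : ℕ) (a : Fin k) : ℝ :=
  if h : s < t then L ⟨s, h⟩ a else 0

/-- The history seen by the instance of the base algorithm that is active in round `t` at a tree
level with period length `m`. That instance was started in round `t / (m * M) * (m * M)`, has been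
updated `t / m % M` times since, and its `j`-th update is the average of the `m` loss vectors of
its `j`-th period. -/
def nodeHistory {k t : ℕ} (M m : ℕ) (L : Fin t → Fin k → ℝ) :
    Fin (t / m % M) → Fin k → ℝ :=
  fun j a => (∑ r ∈ Finset.range m, pastLoss L (t / (m * M) * (m * M) + j * m + r) a) / m

lemma measurable_nodeHistory {k t : ℕ} (M m : ℕ) :
    Measurable (nodeHistory (k := k) (t := t) M m) := by
  refine measurable_pi_lambda _ fun j => measurable_pi_lambda _ fun a => ?_
  refine Measurable.div_const (Finset.measurable_sum _ fun r _ => ?_) _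
  unfold pastLoss
  split_ifs <;> fun_prop

/-- TreeSwap with base algorithm `A` (run with time horizon `M`), branching `M` and depth `d`.
Write the round number `t < M ^ d` in base `M` as `σ₁ ⋯ σ_d`, most significant digit first. The
nodes of the tree are the proper prefixes of such words, and every node carries an instance of `A`.
In round `t` the active instances are those at `σ₁ ⋯ σ_{h-1}`, `h = 1, …, d`; the one at level `h`
has period length `M ^ (d - h)` and has been updated `σ_h` times. The output is the uniform mixture
of the distributions of the `d` active instances. (For `d = 0` there is no instance; then the
output is uniform.) -/
def treeSwap {k : ℕ} [NeZero k] (A : FullAlgorithm k) (M d : ℕ) : FullAlgorithm k where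
  prob t L i :=
    if d = 0 then uniformDist k i
    else (∑ h : Fin d, A.prob _ (nodeHistory M (M ^ (d - 1 - (h : ℕ))) L) i) / d
  prob_mem t L := by
    by_cases hd : d = 0
    · simpa [hd] using uniformDist_mem k
    · have hd' : (d : ℝ) ≠ 0 := by exact_mod_cast hd
      simp only [hd, if_false]
      refine ⟨fun i => div_nonneg (Finset.sum_nonneg fun h _ => (A.prob_mem _ _).1 i)
        (by positivity), ?_⟩
      rw [← Finset.sum_div, Finset.sum_comm]
      simp only [(A.prob_mem _ _).2]
      simp [hd']
  measurable_prob t := by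
    refine measurable_pi_lambda _ fun i => ?_
    by_cases hd : d = 0
    · simp [hd]
    · simp only [hd, if_false]
      refine Measurable.div_const (Finset.measurable_sum _ fun h _ => ?_) _
      exact (measurable_pi_apply i).comp ((A.measurable_prob _).comp (measurable_nodeHistory _ _))

/-- Admissible branchings `M k T` and depths `d k T` of TreeSwap for `k` actions and time horizon
`T`: the tree fits the horizon, and both parameters grow with the horizon. -/
structure IsTreeSwapSchedule (M d : ℕ → ℕ → ℕ) : Prop where
  one_le_depth : ∀ k T, 1 ≤ T → 1 ≤ d k T
  pow_le : ∀ k T, 1 ≤ T → M k T ^ (d k T - 1) ≤ T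
  le_pow : ∀ k T, 1 ≤ T → T ≤ M k T ^ d k T
  tendsto_branching : ∀ k, Filter.Tendsto (M k) Filter.atTop Filter.atTop
  tendsto_depth : ∀ k, Filter.Tendsto (d k) Filter.atTop Filter.atTop

/-! ### Bandit learning against adaptive adversaries -/

/-- A transcript of length `t`: for every round the random bits used by the algorithm, the action
selected, and the observed loss of that action. -/
abbrev Transcript (k : ℕ) (Ω : Type) (t : ℕ) : Type := Fin t → Ω × Fin k × ℝ

/-- A bandit learning algorithm over the actions `Fin k`: in every round fresh random bits are drawn
from `law`, independently of the past, and the action is a deterministic function of the transcript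
so far and of the random bits of the current round. -/
structure BanditAlgorithm (k : ℕ) (Ω : Type) [MeasurableSpace Ω] where
  law : Measure Ω
  isProbabilityMeasure_law : IsProbabilityMeasure law
  act : (t : ℕ) → Transcript k Ω t → Ω → Fin k
  measurable_act : ∀ t, Measurable (fun q : Transcript k Ω t × Ω => act t q.1 q.2)

attribute [instance] BanditAlgorithm.isProbabilityMeasure_law

/-- An adaptive adversary with losses in `[0, 1]`: the loss vector of round `t` is a function of the
transcript of the earlier rounds, including the random bits used by the algorithm in them. -/
structure Adversary (k : ℕ) (Ω : Type) [MeasurableSpace Ω] where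
  loss : (t : ℕ) → Transcript k Ω t → Fin k → ℝ
  loss_mem : ∀ t φ a, loss t φ a ∈ Set.Icc (0 : ℝ) 1
  measurable_loss : ∀ t, Measurable (loss t)

namespace BanditAlgorithm

variable {k : ℕ} {Ω : Type} [MeasurableSpace Ω]

/-- The transcript of the first `t` rounds that results from the algorithm, the loss functions `ℓ`
and the realization `ω` of the random bits. -/
def transcript (f : BanditAlgorithm k Ω) (ℓ : (t : ℕ) → Transcript k Ω t → Fin k → ℝ)
    (ω : ℕ → Ω) : (t : ℕ) → Transcript k Ω t
  | 0 => Fin.elim0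
  | t + 1 =>
    let φ := f.transcript ℓ ω t
    let a := f.act t φ (ω t)
    Fin.snoc (α := fun _ => Ω × Fin k × ℝ) φ (ω t, a, ℓ t φ a)

/-- The action selected in round `t`. -/
def action (f : BanditAlgorithm k Ω) (ℓ : (t : ℕ) → Transcript k Ω t → Fin k → ℝ)
    (ω : ℕ → Ω) (t : ℕ) : Fin k :=
  f.act t (f.transcript ℓ ω t) (ω t)

/-- The joint law of the random bits of all rounds, which are independent. -/
def bitsLaw (f : BanditAlgorithm k Ω) : Measure (ℕ → Ω) :=
  Measure.infinitePi (fun _ : ℕ => f.law)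

/-- The swap regret over `T` rounds: the maximum over all swap functions `χ` of the expected
difference between the loss of the algorithm and the loss after the swap. -/
def swapRegret (f : BanditAlgorithm k Ω) (ℓ : Adversary k Ω) (T : ℕ) : ℝ :=
  ⨆ χ : Fin k → Fin k, ∫ ω, ∑ t ∈ Finset.range T,
    (ℓ.loss t (f.transcript ℓ.loss ω t) (f.action ℓ.loss ω t) -
      ℓ.loss t (f.transcript ℓ.loss ω t) (χ (f.action ℓ.loss ω t))) ∂f.bitsLaw

/-- The probability, over the random bits, that action `i` is selected after the `t` rounds with
selected actions and observed losses `π`. -/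
def selectProb (f : BanditAlgorithm k Ω) {t : ℕ} (π : Fin t → Fin k × ℝ) (i : Fin k) : ℝ :=
  f.bitsLaw.real {ω | f.act t (fun s => (ω s, π s)) (ω t) = i}

/-- Monotonicity: if in one round `s` of the history of selected actions and observed losses the
loss of the action selected there is lowered, and nothing else is changed, then the probability
that this action is selected in a later round does not decrease. -/
def IsMonotone (f : BanditAlgorithm k Ω) : Prop :=
  ∀ (t : ℕ) (π : Fin t → Fin k × ℝ), (∀ s, (π s).2 ∈ Set.Icc (0 : ℝ) 1) →
    ∀ (s : Fin t) (x : ℝ), 0 ≤ x → x ≤ (π s).2 →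
      f.selectProb π (π s).1 ≤ f.selectProb (Function.update π s ((π s).1, x)) (π s).1

/-- Monotonicity in the underlying losses: if in a fixed sequence of loss vectors the loss of one
action `i` in one round `s` is lowered, then the probability that `i` is selected in a later round
`t` does not decrease. -/
def IsLossMonotone (f : BanditAlgorithm k Ω) : Prop :=
  ∀ l : ℕ → Fin k → ℝ, (∀ t a, l t a ∈ Set.Icc (0 : ℝ) 1) →
    ∀ (s : ℕ) (i : Fin k) (x : ℝ), 0 ≤ x → x ≤ l s i → ∀ t, s < t →
      f.bitsLaw.real {ω | f.action (fun r _ => l r) ω t = i} ≤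
        f.bitsLaw.real {ω | f.action
          (fun r _ => Function.update l s (Function.update (l s) i x) r) ω t = i}

end BanditAlgorithm

/-! ### MonoBandit -/

/-- The values of the explore/exploit coin. -/
inductive Coin (k : ℕ) : Type
  | exploit : Coin k
  | explore (i : Fin k) : Coin k
deriving DecidableEq, Fintype

instance (k : ℕ) : MeasurableSpace (Coin k) := ⊤

instance (k : ℕ) : DiscreteMeasurableSpace (Coin k) := ⟨fun _ => trivial⟩

/-- The coin shows `exploit` with probability `1 - ε` and `explore i` with probability `ε / k`. -/
def coinLaw (k : ℕ) (ε : unitInterval) : Measure (Coin k) :=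
  ENNReal.ofReal (1 - ε) • Measure.dirac Coin.exploit +
    ∑ i : Fin k, ENNReal.ofReal (ε / k) • Measure.dirac (Coin.explore i)

lemma isProbabilityMeasure_coinLaw (k : ℕ) [NeZero k] (ε : unitInterval) :
    IsProbabilityMeasure (coinLaw k ε) := by
  constructor
  have hk : (k : ℝ) ≠ 0 := by exact_mod_cast NeZero.ne k
  have h0 : (0 : ℝ) ≤ ε := ε.2.1
  have h1 : (0 : ℝ) ≤ 1 - ε := sub_nonneg.2 ε.2.2
  have h2 : (0 : ℝ) ≤ ε / k := by positivity
  simp only [coinLaw, Measure.coe_add, Measure.coe_smul, Measure.coe_finsetSum, Pi.add_apply,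
    Pi.smul_apply, Finset.sum_apply, measure_univ, smul_eq_mul, mul_one, Finset.sum_const,
    Finset.card_univ, Fintype.card_fin, nsmul_eq_mul]
  rw [← ENNReal.ofReal_natCast, ← ENNReal.ofReal_mul (by positivity),
    ← ENNReal.ofReal_add h1 (by positivity), mul_div_cancel₀ _ hk]
  simp

/-- Sampling from a distribution `p` on `Fin k` with a uniform `u ∈ [0, 1]`: the first action whose
cumulative probability reaches `u`. -/
def sampleAction {k : ℕ} [NeZero k] (p : Fin k → ℝ) (u : unitInterval) : Fin k :=
  if h : (Finset.univ.filter fun i : Fin k => (u : ℝ) ≤ ∑ j ∈ Finset.Iic i, p j).Nonempty then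
    Finset.min' _ h
  else 0

lemma measurable_sampleAction {k : ℕ} [NeZero k] :
    Measurable (fun q : (Fin k → ℝ) × unitInterval => sampleAction q.1 q.2) := by
  have key : (fun q : (Fin k → ℝ) × unitInterval => sampleAction q.1 q.2) =
      (fun v : Fin k → Prop => by
        classical
        exact if h : (Finset.univ.filter v).Nonempty then Finset.min' _ h else 0) ∘
      (fun q i => (q.2 : ℝ) ≤ ∑ j ∈ Finset.Iic i, q.1 j) := by
    funext q
    simp only [Function.comp, sampleAction]
  rw [key]
  refine (measurable_of_finite _).comp (measurable_pi_lambda _ fun i => ?_)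
  refine measurableSet_setOfPred.1 (measurableSet_le (by fun_prop) ?_)
  exact Finset.measurable_sum _ fun j _ => by fun_prop

/-- The sampled loss vector of a round in which the coin showed `c`, the action `a` was selected and
its loss `b` was observed: `k * b / ε` at the explored action and `0` elsewhere, and the zero vector
in an exploit round. In an explore round of an actual run, `a` is the explored action. -/
def sampledLoss {k : ℕ} (ε : ℝ) : Coin k → Fin k → ℝ → Fin k → ℝ
  | Coin.exploit, _, _ => 0
  | Coin.explore i, a, b => if a = i then Pi.single i (k * b / ε) else 0

lemma measurable_sampledLoss {k : ℕ} (ε : ℝ) :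
    Measurable (fun q : Coin k × Fin k × ℝ => sampledLoss ε q.1 q.2.1 q.2.2) := by
  refine measurable_from_prod_countable_right fun c => ?_
  refine measurable_from_prod_countable_right fun a => ?_
  cases c with
  | exploit => exact measurable_const
  | explore i =>
    simp only [sampledLoss]
    split_ifs
    · refine measurable_pi_lambda _ fun j => ?_
      by_cases hj : j = i
      · subst hj
        simp only [Pi.single_eq_same]
        fun_prop
      · simp [Pi.single_eq_of_ne hj]
    · exact measurable_const

/-- The distribution from which MonoBandit draws its action in an exploit round: uniform in the first
round, and afterwards the distribution that the full-feedback algorithm `A` plays on the sampled loss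
vectors. -/
def exploitDist {k : ℕ} {S : Type} (ε : ℝ) (A : FullAlgorithm k) (t : ℕ)
    (φ : Transcript k (Coin k × S) t) : Fin k → ℝ :=
  if t = 0 then uniformDist k
  else A.prob t (fun s => sampledLoss ε (φ s).1.1 (φ s).2.1 (φ s).2.2)

lemma measurable_exploitDist {k : ℕ} {S : Type} [MeasurableSpace S] (ε : ℝ)
    (A : FullAlgorithm k) (t : ℕ) : Measurable (exploitDist (S := S) ε A t) := by
  unfold exploitDist
  split_ifs
  · exact measurable_const
  · refine (A.measurable_prob t).comp (measurable_pi_lambda _ fun s => ?_)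
    exact (measurable_sampledLoss (k := k) ε).comp
      (f := fun φ : Transcript k (Coin k × S) t => ((φ s).1.1, (φ s).2.1, (φ s).2.2))
      (by fun_prop)

/-- The action of a round with coin `c`: the explored action, or in an exploit round an action sampled
from the distribution `p` with the uniform `u`. -/
def coinAction {k : ℕ} [NeZero k] (p : Fin k → ℝ) (u : unitInterval) : Coin k → Fin k
  | Coin.explore i => i
  | Coin.exploit => sampleAction p u

lemma measurable_coinAction {k : ℕ} [NeZero k] :
    Measurable (fun q : Coin k × (Fin k → ℝ) × unitInterval => coinAction q.2.1 q.2.2 q.1) := by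
  refine measurable_from_prod_countable_right fun c => ?_
  cases c with
  | explore i => exact measurable_const
  | exploit => exact measurable_sampleAction

/-- MonoBandit with exploration probability `ε` and full-feedback algorithm `A`. The random bits of a
round are the explore/exploit coin and, independently of it, a uniform number from `[0, 1]` with
which the action of an exploit round is sampled. -/
def monoBandit {k : ℕ} [NeZero k] (ε : unitInterval) (A : FullAlgorithm k) :
    BanditAlgorithm k (Coin k × unitInterval) where
  law := (coinLaw k ε).prod volume
  isProbabilityMeasure_law := by
    have := isProbabilityMeasure_coinLaw k ε
    infer_instance
  act t φ r := coinAction (exploitDist ε A t φ) r.2 r.1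
  measurable_act t := by
    have h : Measurable (fun q : Transcript k (Coin k × unitInterval) t × (Coin k × unitInterval) =>
        (q.2.1, exploitDist ε A t q.1, q.2.2)) :=
      (measurable_fst.comp measurable_snd).prodMk
        (((measurable_exploitDist ε A t).comp measurable_fst).prodMk
          (measurable_snd.comp measurable_snd))
    exact measurable_coinAction.comp h

/-- MonoBandit(TreeSwap) with base algorithm `A`, branching `M`, depth `d` and exploration
probability `ε`. The sampled losses lie in `[0, k / ε]`, so TreeSwap is run for this range. -/
def monoBanditTreeSwap {k : ℕ} [NeZero k] (A : FullAlgorithm k) (M d : ℕ) (ε : unitInterval) :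
    BanditAlgorithm k (Coin k × unitInterval) :=
  monoBandit ε ((treeSwap A M d).rescale (k / ε))

end

/-!
TreeSwap. Consider the level of the tree whose instances have period `m`. Its distribution is
constant on every period, so after any swap its loss is at least the loss of the best fixed actions
for the single periods of length `m`. By the external regret bound its own loss is at most the loss
of the best fixed actions for the periods of length `m * M`, up to `R M / M` per round. As `m` runs
through `1, M, …, M ^ (d - 1)` the swap regrets of the levels telescope, so their average over the
`d` levels is at most `1 / d + O(R M / M)` per round.

MonoBandit. The losses passed to the full-feedback algorithm are unbiased estimates, at most
`k / ε`, of the true losses, so a full-feedback swap regret `δ * T` for losses in `[0, 1]` costs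
`k / ε * δ * T` here, and exploration costs `2 * ε * T`; `ε = √(k * δ)` balances the two. Dividing
the regret by `2 * √k` makes it small relative to `T` for large `k` by the trivial bound `T`, and
for each of the remaining finitely many `k` by the rate just found, so that the supremum over `k` of
the quotients is still `o(T)`.

Monotonicity survives averaging losses, mixing distributions and sampling. In MonoBandit, moreover,
lowering a loss lowers a single coordinate of the estimate passed on, for every outcome of the coin.
-/

/-! ### Lowering one coordinate of a vector -/

/-- `LowersAt i v' v` says that `v'` arises from `v` by lowering (or keeping) the coordinate `i`.
All monotonicity properties of algorithms are propagated in terms of this relation. -/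
def LowersAt {ι α : Type*} [LE α] (i : ι) (v' v : ι → α) : Prop :=
  v' i ≤ v i ∧ ∀ a ≠ i, v' a = v a

namespace LowersAt

variable {ι α : Type*} {i : ι}

lemma refl [Preorder α] (i : ι) (v : ι → α) : LowersAt i v v :=
  ⟨le_rfl, fun _ _ => rfl⟩

lemma update [DecidableEq ι] [LE α] {v : ι → α} {x : α} (hx : x ≤ v i) :
    LowersAt i (Function.update v i x) v :=
  ⟨by simpa using hx, fun _ ha => Function.update_of_ne ha _ _⟩

lemma update_apply [DecidableEq ι] [Preorder α] {κ : Type*} [DecidableEq κ] {L : κ → ι → α}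
    {s : κ} {x : α} (hx : x ≤ L s i) (r : κ) :
    LowersAt i (Function.update L s (Function.update (L s) i x) r) (L r) := by
  rcases eq_or_ne r s with rfl | hr
  · simpa using update hx
  · simpa [hr] using refl i (L r)

lemma update_apply_eq [DecidableEq ι] [LE α] {v' v : ι → α} (h : LowersAt i v' v) :
    Function.update v i (v' i) = v' := by
  funext a
  rcases eq_or_ne a i with rfl | ha
  · simp
  · simp [ha, h.2 a ha]

lemma sum [AddCommMonoid α] [Preorder α] [IsOrderedAddMonoid α] {κ : Type*} {s : Finset κ}
    {f' f : κ → ι → α} (h : ∀ r ∈ s, LowersAt i (f' r) (f r)) :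
    LowersAt i (fun a => ∑ r ∈ s, f' r a) (fun a => ∑ r ∈ s, f r a) :=
  ⟨Finset.sum_le_sum fun r hr => (h r hr).1,
    fun a ha => Finset.sum_congr rfl fun r hr => (h r hr).2 a ha⟩

lemma div_const {v' v : ι → ℝ} (h : LowersAt i v' v) {c : ℝ} (hc : 0 ≤ c) :
    LowersAt i (fun a => v' a / c) (fun a => v a / c) :=
  ⟨div_le_div_of_nonneg_right h.1 hc, fun a ha => congrArg (· / c) (h.2 a ha)⟩

end LowersAt

lemma update_update_apply_mem {ι κ α : Type*} [DecidableEq ι] [DecidableEq κ] {L : κ → ι → α}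
    {S : Set α} (hL : ∀ r a, L r a ∈ S) {s : κ} {i : ι} {x : α} (hx : x ∈ S) (r : κ) (a : ι) :
    Function.update L s (Function.update (L s) i x) r a ∈ S := by
  rcases eq_or_ne r s with rfl | hr
  · rcases eq_or_ne a i with rfl | ha
    · simpa using hx
    · simpa [ha] using hL r a
  · simpa [hr] using hL r a

/-! ### Monotonicity under full feedback -/

namespace FullAlgorithm

variable {k : ℕ} {A : FullAlgorithm k}

lemma IsMonotone.prob_le (hA : A.IsMonotone) {t : ℕ} {L' L : Fin t → Fin k → ℝ}
    (hL' : ∀ s a, L' s a ∈ Set.Icc (0 : ℝ) 1) (hL : ∀ s a, L s a ∈ Set.Icc (0 : ℝ) 1) {i : Fin k}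
    (h : ∀ s, LowersAt i (L' s) (L s)) : A.prob t L i ≤ A.prob t L' i := by
  classical
  suffices key : ∀ S : Finset (Fin t), A.prob t L i ≤ A.prob t (S.piecewise L' L) i by
    simpa using key Finset.univ
  intro S
  induction S using Finset.induction_on with
  | empty => simp
  | insert s S hs ih =>
    have hmem : ∀ r a, S.piecewise L' L r a ∈ Set.Icc (0 : ℝ) 1 := fun r =>
      S.piecewise_cases L' L (fun v => ∀ a, v a ∈ Set.Icc (0 : ℝ) 1) (hL' r) (hL r)
    have hsL : S.piecewise L' L s = L s := S.piecewise_eq_of_notMem _ _ hs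
    have hstep := hA t _ hmem s i (L' s i) (hL' s i).1 (by simpa [hsL] using (h s).1)
    rw [hsL, (h s).update_apply_eq, ← Finset.piecewise_insert] at hstep
    exact ih.trans hstep

lemma IsMonotone.rescale_prob_le (hA : A.IsMonotone) {B : ℝ} (hB : 0 < B) {t : ℕ}
    {L' L : Fin t → Fin k → ℝ} (hL' : ∀ s a, L' s a ∈ Set.Icc 0 B)
    (hL : ∀ s a, L s a ∈ Set.Icc 0 B) {i : Fin k} (h : ∀ s, LowersAt i (L' s) (L s)) :
    (A.rescale B).prob t L i ≤ (A.rescale B).prob t L' i := by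
  have hmem : ∀ x ∈ Set.Icc 0 B, x / B ∈ Set.Icc (0 : ℝ) 1 := fun x hx =>
    ⟨div_nonneg hx.1 hB.le, (div_le_one hB).2 hx.2⟩
  exact hA.prob_le (fun s a => hmem _ (hL' s a)) (fun s a => hmem _ (hL s a))
    fun s => (h s).div_const hB.le

end FullAlgorithm

section History

variable {k t : ℕ} {L' L : Fin t → Fin k → ℝ}

lemma pastLoss_mem {S : Set ℝ} (hS : 0 ∈ S) (hL : ∀ s a, L s a ∈ S) (s : ℕ) (a : Fin k) :
    pastLoss L s a ∈ S := by
  unfold pastLoss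
  split_ifs
  exacts [hL _ _, hS]

lemma sum_range_div_mem_Icc {f : ℕ → ℝ} (hf : ∀ r, f r ∈ Set.Icc (0 : ℝ) 1) (m : ℕ) :
    (∑ r ∈ Finset.range m, f r) / m ∈ Set.Icc (0 : ℝ) 1 := by
  refine ⟨div_nonneg (Finset.sum_nonneg fun r _ => (hf r).1) (by positivity), ?_⟩
  refine div_le_one_of_le₀ ?_ (by positivity)
  simpa using Finset.sum_le_sum fun r (_ : r ∈ Finset.range m) => (hf r).2

lemma nodeHistory_mem_Icc (hL : ∀ s a, L s a ∈ Set.Icc (0 : ℝ) 1) (M m : ℕ)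
    (j : Fin (t / m % M)) (a : Fin k) : nodeHistory M m L j a ∈ Set.Icc (0 : ℝ) 1 :=
  sum_range_div_mem_Icc (fun _ => pastLoss_mem (by simp) hL _ a) m

lemma lowersAt_pastLoss {i : Fin k} (h : ∀ s, LowersAt i (L' s) (L s)) (s : ℕ) :
    LowersAt i (pastLoss L' s) (pastLoss L s) := by
  by_cases hs : s < t
  · simpa [LowersAt, pastLoss, hs] using h ⟨s, hs⟩
  · simp [LowersAt, pastLoss, hs]

lemma lowersAt_nodeHistory {i : Fin k} (h : ∀ s, LowersAt i (L' s) (L s)) (M m : ℕ)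
    (j : Fin (t / m % M)) : LowersAt i (nodeHistory M m L' j) (nodeHistory M m L j) :=
  (LowersAt.sum fun _ _ => lowersAt_pastLoss h _).div_const (Nat.cast_nonneg m)

end History

lemma treeSwap_isMonotone {k : ℕ} [NeZero k] {A : FullAlgorithm k} (hA : A.IsMonotone)
    (M d : ℕ) : (treeSwap A M d).IsMonotone := by
  intro t L hL s i x hx hxL
  set L' := Function.update L s (Function.update (L s) i x)
  have hlower : ∀ r, LowersAt i (L' r) (L r) := LowersAt.update_apply hxL
  have hL' : ∀ r a, L' r a ∈ Set.Icc (0 : ℝ) 1 :=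
    update_update_apply_mem hL ⟨hx, hxL.trans (hL s i).2⟩
  by_cases hd : d = 0
  · simp [treeSwap, hd]
  simp only [treeSwap, hd, if_false]
  gcongr with h
  exact hA.prob_le (nodeHistory_mem_Icc hL' _ _) (nodeHistory_mem_Icc hL _ _)
    (lowersAt_nodeHistory hlower _ _)

/-! ### Multiplicative Weights -/

/-- The exponential-weights distribution with learning rate `η` for the cumulative losses `c`. -/
noncomputable def expWeights {ι : Type*} [Fintype ι] (η : ℝ) (c : ι → ℝ) (i : ι) : ℝ :=
  Real.exp (-η * c i) / ∑ j, Real.exp (-η * c j)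

lemma multiplicativeWeights_prob (k : ℕ) [NeZero k] (N t : ℕ) (L : Fin t → Fin k → ℝ) :
    (multiplicativeWeights k N).prob t L =
      expWeights (Real.sqrt (Real.log k / N)) (fun a => ∑ s, L s a) :=
  rfl

lemma exp_neg_le_quadratic {x : ℝ} (hx : 0 ≤ x) : Real.exp (-x) ≤ 1 - x + x ^ 2 / 2 := by
  have h0 : 0 < 1 + x + x ^ 2 / 2 := by positivity
  calc Real.exp (-x) = (Real.exp x)⁻¹ := Real.exp_neg x
    _ ≤ (1 + x + x ^ 2 / 2)⁻¹ := inv_anti₀ h0 (Real.quadratic_le_exp_of_nonneg hx)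
    _ ≤ 1 - x + x ^ 2 / 2 := by
      rw [inv_le_iff_one_le_mul₀ h0]
      nlinarith [sq_nonneg (x ^ 2)]

section ExpWeights

variable {ι : Type*} [Fintype ι] {η : ℝ}

lemma expWeights_le_of_lowersAt (hη : 0 ≤ η) {c' c : ι → ℝ} {i : ι} (h : LowersAt i c' c) :
    expWeights η c i ≤ expWeights η c' i := by
  classical
  have hi : Real.exp (-η * c i) ≤ Real.exp (-η * c' i) :=
    Real.exp_le_exp.2 (mul_le_mul_of_nonpos_left h.1 (neg_nonpos.2 hη))
  have hrest : ∑ j ∈ Finset.univ.erase i, Real.exp (-η * c' j) =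
      ∑ j ∈ Finset.univ.erase i, Real.exp (-η * c j) :=
    Finset.sum_congr rfl fun j hj => by rw [h.2 j (Finset.ne_of_mem_erase hj)]
  have hrest0 : 0 ≤ ∑ j ∈ Finset.univ.erase i, Real.exp (-η * c j) := by positivity
  unfold expWeights
  rw [← Finset.add_sum_erase _ _ (Finset.mem_univ i),
    ← Finset.add_sum_erase _ (fun j => Real.exp (-η * c' j)) (Finset.mem_univ i), hrest,
    div_le_div_iff₀ (by positivity) (by positivity)]
  nlinarith [mul_le_mul_of_nonneg_right hi hrest0]

lemma sum_exp_mul_expWeights_dotProduct [Nonempty ι] (c v : ι → ℝ) :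
    (∑ j, Real.exp (-η * c j)) * (expWeights η c ⬝ᵥ v) = ∑ j, Real.exp (-η * c j) * v j := by
  have hW : ∑ j, Real.exp (-η * c j) ≠ 0 :=
    (Finset.sum_pos (fun j _ => Real.exp_pos _) Finset.univ_nonempty).ne'
  simp only [dotProduct, Finset.mul_sum, expWeights]
  refine Finset.sum_congr rfl fun j _ => ?_
  field_simp [hW]

lemma sum_exp_add_le [Nonempty ι] (hη : 0 ≤ η) (c : ι → ℝ) {v : ι → ℝ}
    (hv : ∀ a, v a ∈ Set.Icc (0 : ℝ) 1) :
    ∑ j, Real.exp (-η * (c j + v j)) ≤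
      (∑ j, Real.exp (-η * c j)) * Real.exp (-η * (expWeights η c ⬝ᵥ v) + η ^ 2 / 2) := by
  have hterm : ∀ j, Real.exp (-η * v j) ≤ 1 - η * v j + η ^ 2 / 2 := by
    intro j
    have hquad := exp_neg_le_quadratic (mul_nonneg hη (hv j).1)
    have hsq : (η * v j) ^ 2 ≤ η ^ 2 := by
      rw [mul_pow]
      exact mul_le_of_le_one_right (sq_nonneg _) (pow_le_one₀ (hv j).1 (hv j).2)
    rw [neg_mul]
    linarith
  calc ∑ j, Real.exp (-η * (c j + v j))
      ≤ ∑ j, Real.exp (-η * c j) * (1 - η * v j + η ^ 2 / 2) := by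
        gcongr with j
        rw [mul_add, Real.exp_add]
        exact mul_le_mul_of_nonneg_left (hterm j) (Real.exp_pos _).le
    _ = (∑ j, Real.exp (-η * c j)) * (-η * (expWeights η c ⬝ᵥ v) + η ^ 2 / 2 + 1) := by
        have h := sum_exp_mul_expWeights_dotProduct (η := η) c v
        have hexpand : ∀ j, Real.exp (-η * c j) * (1 - η * v j + η ^ 2 / 2) =
            Real.exp (-η * c j) * (η ^ 2 / 2 + 1) - η * (Real.exp (-η * c j) * v j) :=
          fun j => by ring
        simp only [hexpand, Finset.sum_sub_distrib, ← Finset.sum_mul, ← Finset.mul_sum, ← h]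
        ring
    _ ≤ _ := by
        gcongr
        exact Real.add_one_le_exp _

lemma sum_exp_sum_range_le [Nonempty ι] (hη : 0 ≤ η) {L : ℕ → ι → ℝ}
    (hL : ∀ t a, L t a ∈ Set.Icc (0 : ℝ) 1) (n : ℕ) :
    ∑ j, Real.exp (-η * ∑ s ∈ Finset.range n, L s j) ≤ Fintype.card ι * Real.exp
      (-η * ∑ t ∈ Finset.range n,
        expWeights η (fun a => ∑ s ∈ Finset.range t, L s a) ⬝ᵥ L t + n * (η ^ 2 / 2)) := by
  induction n with
  | zero => simp
  | succ n ih =>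
    simp only [Finset.sum_range_succ _ n]
    refine (sum_exp_add_le hη _ (hL n)).trans
      ((mul_le_mul_of_nonneg_right ih (Real.exp_pos _).le).trans_eq ?_)
    rw [mul_assoc, ← Real.exp_add]
    push_cast
    congr 2
    ring

lemma mul_expWeights_regret_le [Nonempty ι] (hη : 0 ≤ η) {L : ℕ → ι → ℝ}
    (hL : ∀ t a, L t a ∈ Set.Icc (0 : ℝ) 1) (n : ℕ) (i : ι) :
    η * ∑ t ∈ Finset.range n,
        (expWeights η (fun a => ∑ s ∈ Finset.range t, L s a) ⬝ᵥ L t - L t i) ≤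
      Real.log (Fintype.card ι) + n * (η ^ 2 / 2) := by
  have hcard : (0 : ℝ) < Fintype.card ι := by exact_mod_cast Fintype.card_pos
  have hi := (Finset.single_le_sum (f := fun j => Real.exp (-η * ∑ s ∈ Finset.range n, L s j))
    (fun j _ => (Real.exp_pos _).le) (Finset.mem_univ i)).trans (sum_exp_sum_range_le hη hL n)
  rw [← Real.exp_log hcard, ← Real.exp_add, Real.exp_le_exp] at hi
  rw [Finset.sum_sub_distrib]
  linarith

end ExpWeights

lemma multiplicativeWeights_isMonotone (k : ℕ) [NeZero k] (N : ℕ) :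
    (multiplicativeWeights k N).IsMonotone := fun _ _ _ _ _ _ _ hx =>
  expWeights_le_of_lowersAt (Real.sqrt_nonneg _)
    (LowersAt.sum fun r _ => LowersAt.update_apply hx r)

lemma FullAlgorithm.regret_of_one (A : FullAlgorithm 1) (N : ℕ) (L : ℕ → Fin 1 → ℝ) (i : Fin 1) :
    A.regret N L i = 0 := by
  refine Finset.sum_eq_zero fun t _ => ?_
  have hs := (A.prob_mem t (fun s => L s)).2
  rw [Fin.sum_univ_one] at hs
  rw [Fin.sum_univ_one, hs, Subsingleton.elim i 0, one_mul, sub_self]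

lemma multiplicativeWeights_regret_le (k : ℕ) [NeZero k] (N : ℕ) {L : ℕ → Fin k → ℝ}
    (hL : ∀ t a, L t a ∈ Set.Icc (0 : ℝ) 1) (i : Fin k) :
    (multiplicativeWeights k N).regret N L i ≤ 2 * Real.sqrt (Real.log k * N) := by
  obtain rfl | hk : k = 1 ∨ 1 < k := by
    have := NeZero.pos k
    omega
  · rw [FullAlgorithm.regret_of_one]
    positivity
  rcases N.eq_zero_or_pos with rfl | hN
  · simp [FullAlgorithm.regret]
  have hN' : (0 : ℝ) < N := by exact_mod_cast hN
  have hlog : 0 < Real.log k := Real.log_pos (by exact_mod_cast hk)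
  set η := Real.sqrt (Real.log k / N) with hη
  have hη0 : 0 < η := Real.sqrt_pos.2 (div_pos hlog hN')
  have hη2 : η ^ 2 * N = Real.log k := by
    rw [hη, Real.sq_sqrt (by positivity)]
    field_simp
  have hsqrt : Real.sqrt (Real.log k * N) = η * N := by
    rw [← hη2, show η ^ 2 * N * N = (η * N) ^ 2 by ring, Real.sqrt_sq (by positivity)]
  have hreg : η * (multiplicativeWeights k N).regret N L i ≤ Real.log k + N * (η ^ 2 / 2) := by
    simpa only [FullAlgorithm.regret, multiplicativeWeights_prob, dotProduct, Finset.sum_range,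
      Fintype.card_fin] using mul_expWeights_regret_le hη0.le hL N i
  rw [hsqrt]
  refine le_of_mul_le_mul_left ?_ hη0
  nlinarith

lemma sqrt_const_mul_isLittleO (c : ℝ) :
    (fun x : ℝ => Real.sqrt (c * x)) =o[Filter.atTop] fun x => x := by
  have hsqrt : (fun x : ℝ => Real.sqrt x) =o[Filter.atTop] fun x => x := by
    have h := (Asymptotics.isLittleO_pow_pow_atTop_of_lt (𝕜 := ℝ) one_lt_two).comp_tendsto
      Real.tendsto_sqrt_atTop
    refine h.congr' (.of_forall fun x => pow_one _) ?_
    filter_upwards [Filter.eventually_ge_atTop 0] with x hx using Real.sq_sqrt hx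
  refine (hsqrt.const_mul_left (Real.sqrt c)).congr' ?_ .rfl
  filter_upwards [Filter.eventually_ge_atTop 0] with x hx
  rw [Real.sqrt_mul' c hx]

lemma multiplicativeWeights_noExternalRegret (k : ℕ) [NeZero k] :
    NoExternalRegret (multiplicativeWeights k) :=
  ⟨fun N => 2 * Real.sqrt (Real.log k * N),
    ((sqrt_const_mul_isLittleO _).const_mul_left 2).comp_tendsto tendsto_natCast_atTop_atTop,
    fun N _ hL => multiplicativeWeights_regret_le k N hL⟩

/-! ### Swap regret of TreeSwap -/

lemma dotProduct_mem_of_mem_stdSimplex {ι : Type*} [Fintype ι] {p v : ι → ℝ} {s : Set ℝ}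
    (hp : p ∈ stdSimplex ℝ ι) (hs : Convex ℝ s) (hv : ∀ a, v a ∈ s) : p ⬝ᵥ v ∈ s :=
  hs.sum_mem (fun a _ => hp.1 a) hp.2 fun a _ => hv a

lemma sum_range_mul_eq_sum_sum {E : Type*} [AddCommMonoid E] (f : ℕ → E) (n m : ℕ) :
    ∑ t ∈ Finset.range (n * m), f t =
      ∑ p ∈ Finset.range n, ∑ r ∈ Finset.range m, f (p * m + r) := by
  induction n with
  | zero => simp
  | succ n ih => rw [Nat.succ_mul, Finset.sum_range_add, ih, Finset.sum_range_succ]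

lemma exists_dvd_between_two_mul {m T : ℕ} (hm : 0 < m) (hmT : m ≤ T) :
    ∃ N, m ∣ N ∧ T ≤ N ∧ N ≤ 2 * T := by
  refine ⟨(T / m + 1) * m, dvd_mul_left _ _, ?_, ?_⟩
  · exact (Nat.lt_div_mul_add hm).le.trans_eq (Nat.succ_mul _ _).symm
  · rw [Nat.succ_mul]
    have := Nat.div_mul_le_self T m
    omega

/-- The swap regret over `T` rounds of the mixed actions `x`, on the losses `L` and for the swap
function `χ`. -/
noncomputable def mixedSwapRegret {k : ℕ} (x L : ℕ → Fin k → ℝ) (T : ℕ) (χ : Fin k → Fin k) : ℝ :=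
  ∑ t ∈ Finset.range T, x t ⬝ᵥ (L t - L t ∘ χ)

namespace FullAlgorithm

variable {k : ℕ}

/-- The distribution played in round `n` on the sequence of loss vectors `L`. -/
def play (A : FullAlgorithm k) (L : ℕ → Fin k → ℝ) (n : ℕ) : Fin k → ℝ :=
  A.prob n (fun s => L s)

lemma play_mem (A : FullAlgorithm k) (L : ℕ → Fin k → ℝ) (n : ℕ) :
    A.play L n ∈ stdSimplex ℝ (Fin k) :=
  A.prob_mem _ _

lemma play_congr (A : FullAlgorithm k) {L' L : ℕ → Fin k → ℝ} {n : ℕ}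
    (h : ∀ s < n, L' s = L s) : A.play L' n = A.play L n :=
  congrArg (A.prob n) (funext fun s => h s s.2)

/-- The worst-case external regret over `N` rounds is at most `R`. -/
def HasRegretLE (A : FullAlgorithm k) (N : ℕ) (R : ℝ) : Prop :=
  ∀ L : ℕ → Fin k → ℝ, (∀ t a, L t a ∈ Set.Icc (0 : ℝ) 1) → ∀ i, A.regret N L i ≤ R

/-- The worst-case swap regret over `T` rounds is at most `S`. -/
def HasSwapRegretLE (A : FullAlgorithm k) (T : ℕ) (S : ℝ) : Prop :=
  ∀ L : ℕ → Fin k → ℝ, (∀ t a, L t a ∈ Set.Icc (0 : ℝ) 1) →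
    ∀ χ, mixedSwapRegret (A.play L) L T χ ≤ S

lemma HasRegretLE.sum_play_dotProduct_le {A : FullAlgorithm k} {N : ℕ} {R : ℝ}
    (hR : A.HasRegretLE N R) {L : ℕ → Fin k → ℝ} (hL : ∀ t a, L t a ∈ Set.Icc (0 : ℝ) 1)
    (i : Fin k) :
    ∑ t ∈ Finset.range N, A.play L t ⬝ᵥ L t ≤ (∑ t ∈ Finset.range N, L t) i + R := by
  have h := hR L hL i
  rw [regret, Finset.sum_sub_distrib] at h
  rw [Finset.sum_apply]
  exact sub_le_iff_le_add'.1 h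

lemma mixedSwapRegret_play_indicator (A : FullAlgorithm k) (L : ℕ → Fin k → ℝ)
    {T N : ℕ} (hTN : T ≤ N) (χ : Fin k → Fin k) :
    mixedSwapRegret (A.play ((Set.Iio T).indicator L)) ((Set.Iio T).indicator L) N χ =
      mixedSwapRegret (A.play L) L T χ := by
  have hin : ∀ t < T, (Set.Iio T).indicator L t = L t := fun t ht =>
    Set.indicator_of_mem (Set.mem_Iio.2 ht) _
  unfold mixedSwapRegret
  rw [← Finset.sum_subset (Finset.range_subset_range.2 hTN)]
  · refine Finset.sum_congr rfl fun t ht => ?_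
    have htT := Finset.mem_range.1 ht
    rw [hin t htT, A.play_congr fun s hs => hin s (hs.trans htT)]
  · intro t _ ht
    have hout : (Set.Iio T).indicator L t = 0 := Set.indicator_of_notMem (by simpa using ht) _
    rw [hout, Pi.zero_comp, sub_zero, dotProduct_zero]

end FullAlgorithm

section Levels

variable {k : ℕ} (A : FullAlgorithm k) (L : ℕ → Fin k → ℝ)

/-- The sum of the loss vectors of the `p`-th period of length `m`. -/
noncomputable def periodSum (m p : ℕ) : Fin k → ℝ :=
  ∑ r ∈ Finset.range m, L (p * m + r)

/-- The average of the loss vectors of the `p`-th period of length `m`. -/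
noncomputable def periodAvg (m p : ℕ) (a : Fin k) : ℝ :=
  periodSum L m p a / m

/-- The total loss in the first `N` rounds if the best fixed action is played in each of the
periods of length `m`. -/
noncomputable def bestPeriodLoss (m N : ℕ) : ℝ :=
  ∑ p ∈ Finset.range (N / m), ⨅ i, periodSum L m p i

/-- The distribution of the instance of `A` that is active in round `t` of TreeSwap with branching
`M`, at the tree level with period length `m`. -/
noncomputable def levelDist (M m t : ℕ) : Fin k → ℝ :=
  A.prob _ (nodeHistory (t := t) M m (fun s => L s))

/-- The value of `levelDist` throughout the `p`-th period of length `m`. The active instance was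
started in period `p / M * M`. -/
noncomputable def nodePlay (M m p : ℕ) : Fin k → ℝ :=
  A.play (fun j => periodAvg L m (p / M * M + j)) (p % M)

lemma levelDist_mem (M m t : ℕ) : levelDist A L M m t ∈ stdSimplex ℝ (Fin k) :=
  A.prob_mem _ _

lemma periodSum_mul (m M p : ℕ) :
    periodSum L (m * M) p = ∑ j ∈ Finset.range M, periodSum L m (p * M + j) := by
  unfold periodSum
  rw [mul_comm m M, sum_range_mul_eq_sum_sum]
  refine Finset.sum_congr rfl fun j _ => Finset.sum_congr rfl fun r _ => congrArg L ?_
  ring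

lemma smul_periodAvg (m p : ℕ) : (m : ℝ) • periodAvg L m p = periodSum L m p := by
  rcases eq_or_ne m 0 with rfl | hm
  · simp [periodSum]
  · ext a
    exact mul_div_cancel₀ _ (Nat.cast_ne_zero.2 hm)

lemma nodePlay_mul_add {M j : ℕ} (hj : j < M) (m p : ℕ) :
    nodePlay A L M m (p * M + j) = A.play (fun j' => periodAvg L m (p * M + j')) j := by
  rw [nodePlay, add_comm (p * M), Nat.add_mul_mod_self_right, Nat.mod_eq_of_lt hj,
    Nat.add_mul_div_right _ _ (by omega), Nat.div_eq_of_lt hj, zero_add]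

lemma levelDist_mul_add {m r : ℕ} (hr : r < m) (M p : ℕ) :
    levelDist A L M m (p * m + r) = nodePlay A L M m p := by
  have hdiv : (p * m + r) / m = p := by
    rw [add_comm, Nat.add_mul_div_right _ _ (by omega), Nat.div_eq_of_lt hr, zero_add]
  have hdiv' : (p * m + r) / (m * M) = p / M := by rw [← Nat.div_div_eq_div_mul, hdiv]
  have hhist : nodeHistory (t := p * m + r) M m (fun s => L s) =
      fun j : Fin ((p * m + r) / m % M) => periodAvg L m (p / M * M + j) := by
    funext j a
    have hlt : ∀ r' < m, (p / M * M + j) * m + r' < p * m + r := by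
      intro r' hr'
      have hj : (j : ℕ) < p % M := by simpa only [hdiv] using j.2
      have hdecomp := Nat.div_add_mod' p M
      have hle := Nat.mul_le_mul_right m (show p / M * M + j + 1 ≤ p by omega)
      rw [Nat.succ_mul] at hle
      omega
    simp only [nodeHistory, periodAvg, periodSum, Finset.sum_apply, hdiv']
    congr 1
    refine Finset.sum_congr rfl fun r' hr' => ?_
    rw [show p / M * (m * M) + j * m + r' = (p / M * M + j) * m + r' by ring]
    simp [pastLoss, hlt r' (Finset.mem_range.1 hr')]
  rw [levelDist, hhist]
  change A.play (fun j => periodAvg L m (p / M * M + j)) _ = _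
  rw [hdiv, nodePlay]

lemma sum_levelDist_dotProduct (v : ℕ → Fin k → ℝ) (M m n : ℕ) :
    ∑ t ∈ Finset.range (n * m), levelDist A L M m t ⬝ᵥ v t =
      ∑ p ∈ Finset.range n, nodePlay A L M m p ⬝ᵥ periodSum v m p := by
  simp only [sum_range_mul_eq_sum_sum, periodSum, dotProduct_sum]
  refine Finset.sum_congr rfl fun p _ => Finset.sum_congr rfl fun r hr => ?_
  rw [levelDist_mul_add A L (Finset.mem_range.1 hr)]

variable {L}

lemma bestPeriodLoss_nonneg [NeZero k] (hL : ∀ t a, 0 ≤ L t a) (m N : ℕ) :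
    0 ≤ bestPeriodLoss L m N := by
  refine Finset.sum_nonneg fun p _ => le_ciInf fun i => ?_
  rw [periodSum, Finset.sum_apply]
  exact Finset.sum_nonneg fun r _ => hL _ i

lemma bestPeriodLoss_le_sum_levelDist (M : ℕ) {m N : ℕ} (h : m ∣ N) (χ : Fin k → Fin k) :
    bestPeriodLoss L m N ≤ ∑ t ∈ Finset.range N, levelDist A L M m t ⬝ᵥ (L t ∘ χ) := by
  conv_rhs => rw [← Nat.div_mul_cancel h]
  rw [sum_levelDist_dotProduct A L (fun t => L t ∘ χ)]
  have hswap : ∀ p a, periodSum (fun t => L t ∘ χ) m p a = periodSum L m p (χ a) := fun p a => by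
    simp [periodSum]
  have hmem : ∀ p, nodePlay A L M m p ⬝ᵥ periodSum (fun t => L t ∘ χ) m p ∈
      Set.Ici (⨅ i, periodSum L m p i) := fun p =>
    dotProduct_mem_of_mem_stdSimplex (A.play_mem _ _) (convex_Ici _) fun a =>
      (ciInf_le (Set.finite_range _).bddBelow (χ a)).trans_eq (hswap p a).symm
  exact Finset.sum_le_sum fun p _ => hmem p

lemma mixedSwapRegret_levelDist_le_of_eq_zero (hL : ∀ t a, L t a ∈ Set.Icc (0 : ℝ) 1)
    {M m T N : ℕ} (hN : m ∣ N) (hTN : T ≤ N) (hT : ∀ t, T ≤ t → L t = 0) (χ : Fin k → Fin k) :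
    mixedSwapRegret (levelDist A L M m) L N χ ≤ T - bestPeriodLoss L m N := by
  have hloss : ∑ t ∈ Finset.range N, levelDist A L M m t ⬝ᵥ L t ≤ T := by
    calc _ = ∑ t ∈ Finset.range T, levelDist A L M m t ⬝ᵥ L t := by
          refine (Finset.sum_subset (Finset.range_subset_range.2 hTN) fun t _ ht => ?_).symm
          rw [hT t (by simpa using ht), dotProduct_zero]
      _ ≤ ∑ t ∈ Finset.range T, 1 := Finset.sum_le_sum fun t _ =>
          dotProduct_mem_of_mem_stdSimplex (levelDist_mem A L M m t) (convex_Iic 1)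
            fun a => (hL t a).2
      _ = T := by simp
  have hswapped := bestPeriodLoss_le_sum_levelDist A M (L := L) hN χ
  simp only [mixedSwapRegret, dotProduct_sub, Finset.sum_sub_distrib]
  linarith

variable {A}

lemma sum_nodePlay_dotProduct_le {M : ℕ} {R : ℝ} (hR : A.HasRegretLE M R)
    (hL : ∀ t a, L t a ∈ Set.Icc (0 : ℝ) 1) (m p : ℕ) (i : Fin k) :
    ∑ j ∈ Finset.range M, nodePlay A L M m (p * M + j) ⬝ᵥ periodSum L m (p * M + j) ≤
      periodSum L (m * M) p i + m * R := by
  have havg : ∀ j a, periodAvg L m (p * M + j) a ∈ Set.Icc (0 : ℝ) 1 := fun j a => by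
    rw [periodAvg, periodSum, Finset.sum_apply]
    exact sum_range_div_mem_Icc (fun r => hL _ a) m
  calc _ = m * ∑ j ∈ Finset.range M,
        A.play (fun j' => periodAvg L m (p * M + j')) j ⬝ᵥ periodAvg L m (p * M + j) := by
        rw [Finset.mul_sum]
        refine Finset.sum_congr rfl fun j hj => ?_
        rw [nodePlay_mul_add A L (Finset.mem_range.1 hj), ← smul_periodAvg, dotProduct_smul,
          smul_eq_mul]
    _ ≤ m * ((∑ j ∈ Finset.range M, periodAvg L m (p * M + j)) i + R) := by
        gcongr
        exact hR.sum_play_dotProduct_le havg i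
    _ = periodSum L (m * M) p i + m * R := by
        rw [periodSum_mul, mul_add, ← smul_eq_mul, ← Pi.smul_apply, Finset.smul_sum]
        simp only [smul_periodAvg]

lemma sum_levelDist_dotProduct_le [NeZero k] {M : ℕ} (hM : 0 < M) {R : ℝ}
    (hR : A.HasRegretLE M R) (hL : ∀ t a, L t a ∈ Set.Icc (0 : ℝ) 1) {m N : ℕ} (h : m * M ∣ N) :
    ∑ t ∈ Finset.range N, levelDist A L M m t ⬝ᵥ L t ≤
      bestPeriodLoss L (m * M) N + N / M * R := by
  have hN : N / (m * M) * M * m = N := by rw [mul_assoc, mul_comm M m, Nat.div_mul_cancel h]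
  have hNR : (N : ℝ) / M * R = ∑ _p ∈ Finset.range (N / (m * M)), m * R := by
    have hM' : (M : ℝ) ≠ 0 := by positivity
    have hN' : ((N / (m * M) : ℕ) : ℝ) * M * m = N := by exact_mod_cast hN
    rw [Finset.sum_const, Finset.card_range, nsmul_eq_mul, ← hN']
    field_simp
  conv_lhs => rw [← hN]
  rw [sum_levelDist_dotProduct, sum_range_mul_eq_sum_sum, bestPeriodLoss, hNR,
    ← Finset.sum_add_distrib]
  refine Finset.sum_le_sum fun p _ => ?_
  obtain ⟨i, hi⟩ := exists_eq_ciInf_of_finite (f := fun i => periodSum L (m * M) p i)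
  rw [← hi]
  exact sum_nodePlay_dotProduct_le hR hL m p i

end Levels

section TreeSwap

variable {k : ℕ} [NeZero k] {A : FullAlgorithm k} {L : ℕ → Fin k → ℝ} {M d T N : ℕ} {R : ℝ}

lemma treeSwap_play (A : FullAlgorithm k) (L : ℕ → Fin k → ℝ) (M d t : ℕ) :
    (treeSwap A M (d + 1)).play L t =
      ((d + 1 : ℕ) : ℝ)⁻¹ • ∑ e ∈ Finset.range (d + 1), levelDist A L M (M ^ e) t := by
  ext a
  simp only [FullAlgorithm.play, treeSwap, Nat.succ_ne_zero, if_false, Pi.smul_apply,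
    Finset.sum_apply, smul_eq_mul]
  rw [← Finset.sum_range_reflect (fun e => levelDist A L M (M ^ e) t a), Finset.sum_range,
    div_eq_inv_mul]
  rfl

lemma mixedSwapRegret_treeSwap_play (A : FullAlgorithm k) (L : ℕ → Fin k → ℝ) (M d N : ℕ)
    (χ : Fin k → Fin k) :
    mixedSwapRegret ((treeSwap A M (d + 1)).play L) L N χ =
      (∑ e ∈ Finset.range (d + 1), mixedSwapRegret (levelDist A L M (M ^ e)) L N χ) /
        (d + 1 : ℕ) := by
  simp only [mixedSwapRegret, treeSwap_play, smul_dotProduct, sum_dotProduct, smul_eq_mul,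
    ← Finset.mul_sum]
  rw [Finset.sum_comm, div_eq_inv_mul]

lemma mixedSwapRegret_levelDist_le (hM : 0 < M) (hR : A.HasRegretLE M R)
    (hL : ∀ t a, L t a ∈ Set.Icc (0 : ℝ) 1) {e : ℕ} (hN : M ^ (e + 1) ∣ N) (χ : Fin k → Fin k) :
    mixedSwapRegret (levelDist A L M (M ^ e)) L N χ ≤
      bestPeriodLoss L (M ^ (e + 1)) N - bestPeriodLoss L (M ^ e) N + N / M * R := by
  have hloss := sum_levelDist_dotProduct_le hM hR hL (m := M ^ e) (pow_succ M e ▸ hN)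
  have hswapped := bestPeriodLoss_le_sum_levelDist A M (L := L)
    ((pow_dvd_pow M e.le_succ).trans hN) χ
  rw [← pow_succ] at hloss
  simp only [mixedSwapRegret, dotProduct_sub, Finset.sum_sub_distrib]
  linarith

lemma treeSwap_mixedSwapRegret_le_of_eq_zero (hM : 0 < M) (hR : A.HasRegretLE M R)
    (hL : ∀ t a, L t a ∈ Set.Icc (0 : ℝ) 1) (hN : M ^ d ∣ N) (hTN : T ≤ N)
    (hT : ∀ t, T ≤ t → L t = 0) (χ : Fin k → Fin k) :
    mixedSwapRegret ((treeSwap A M (d + 1)).play L) L N χ ≤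
      (T + d * (N / M * R)) / (d + 1 : ℕ) := by
  have hlow : ∑ e ∈ Finset.range d, mixedSwapRegret (levelDist A L M (M ^ e)) L N χ ≤
      bestPeriodLoss L (M ^ d) N - bestPeriodLoss L (M ^ 0) N + d * (N / M * R) := by
    calc _ ≤ ∑ e ∈ Finset.range d,
          (bestPeriodLoss L (M ^ (e + 1)) N - bestPeriodLoss L (M ^ e) N + N / M * R) :=
          Finset.sum_le_sum fun e he => mixedSwapRegret_levelDist_le hM hR hL
            ((pow_dvd_pow M (Finset.mem_range.1 he)).trans hN) χ
      _ = _ := by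
          rw [Finset.sum_add_distrib,
            Finset.sum_range_sub (fun e => bestPeriodLoss L (M ^ e) N)]
          simp
  have htop := mixedSwapRegret_levelDist_le_of_eq_zero A hL (M := M) hN hTN hT χ
  have hnonneg := bestPeriodLoss_nonneg (fun t a => (hL t a).1) (M ^ 0) N
  rw [mixedSwapRegret_treeSwap_play, Finset.sum_range_succ]
  exact div_le_div_of_nonneg_right (by linarith) (by positivity)

lemma treeSwap_hasSwapRegretLE (hM : 0 < M) (hd : 1 ≤ d) (hR0 : 0 ≤ R)
    (hR : A.HasRegretLE M R) (hT : M ^ (d - 1) ≤ T) :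
    (treeSwap A M d).HasSwapRegretLE T ((1 / d + 2 * (R / M)) * T) := by
  intro L hL χ
  obtain ⟨d, rfl⟩ := Nat.exists_eq_add_of_le' hd
  rw [Nat.add_sub_cancel] at hT
  obtain ⟨N, hdvd, hTN, hN2⟩ := exists_dvd_between_two_mul (pow_pos hM d) hT
  set L₀ := (Set.Iio T).indicator L
  have hL₀ : ∀ t a, L₀ t a ∈ Set.Icc (0 : ℝ) 1 := fun t a => by
    by_cases ht : t < T <;> simp [L₀, ht, hL t a]
  have hL₀T : ∀ t, T ≤ t → L₀ t = 0 := fun t ht =>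
    Set.indicator_of_notMem (Set.notMem_Iio.2 ht) _
  have hN2' : (N : ℝ) ≤ 2 * T := by exact_mod_cast hN2
  calc mixedSwapRegret ((treeSwap A M (d + 1)).play L) L T χ
      = mixedSwapRegret ((treeSwap A M (d + 1)).play L₀) L₀ N χ :=
        (FullAlgorithm.mixedSwapRegret_play_indicator _ L hTN χ).symm
    _ ≤ (T + d * (N / M * R)) / (d + 1 : ℕ) :=
        treeSwap_mixedSwapRegret_le_of_eq_zero hM hR hL₀ hdvd hTN hL₀T χ
    _ ≤ (T + (d + 1 : ℕ) * (2 * T / M * R)) / (d + 1 : ℕ) := by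
        gcongr
        omega
    _ = (1 / (d + 1 : ℕ) + 2 * (R / M)) * T := by
        have hd0 : ((d + 1 : ℕ) : ℝ) ≠ 0 := by positivity
        field_simp

end TreeSwap

/-! ### Existence of branchings and depths -/

/-- The largest `m` with `m ^ m ≤ T`, an inverse of `m ↦ m ^ m`. A tree of this branching and this
depth fits the horizon `T`. -/
def selfPowRoot (T : ℕ) : ℕ :=
  Nat.findGreatest (fun m => m ^ m ≤ T) T

lemma selfPowRoot_pow_le {T : ℕ} (hT : 1 ≤ T) : selfPowRoot T ^ selfPowRoot T ≤ T :=
  Nat.findGreatest_spec (P := fun m => m ^ m ≤ T) (Nat.zero_le T) (by simpa using hT)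

lemma tendsto_selfPowRoot : Filter.Tendsto selfPowRoot Filter.atTop Filter.atTop := by
  refine Filter.tendsto_atTop.2 fun b => ?_
  filter_upwards [Filter.eventually_ge_atTop (b ^ b), Filter.eventually_ge_atTop b] with T hpow hb
  exact Nat.le_findGreatest hb hpow

lemma exists_isTreeSwapSchedule : ∃ M d : ℕ → ℕ → ℕ, IsTreeSwapSchedule M d := by
  let M : ℕ → ℕ := fun T => max 2 (selfPowRoot T)
  have hM : ∀ T, 1 < M T := fun T => one_lt_two.trans_le (le_max_left _ _)
  refine ⟨fun _ => M, fun _ T => max 1 (Nat.clog (M T) T), fun _ _ _ => le_max_left _ _, ?_, ?_,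
    fun _ => Filter.tendsto_atTop_mono (fun T => le_max_right _ _) tendsto_selfPowRoot,
    fun _ => Filter.tendsto_atTop.2 fun b => ?_⟩
  · intro _ T hT
    rcases hT.eq_or_lt with rfl | hT
    · simp
    · rw [max_eq_right (Nat.clog_pos (hM T) hT)]
      exact (Nat.pow_pred_clog_lt_self (hM T) hT).le
  · intro _ T _
    exact (Nat.le_pow_clog (hM T) T).trans
      (Nat.pow_le_pow_right (Nat.zero_lt_of_lt (hM T)) (le_max_right _ _))
  · filter_upwards [tendsto_selfPowRoot.eventually_ge_atTop (max 2 (b + 1)),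
      Filter.eventually_ge_atTop 1] with T hT hT1
    obtain ⟨h2, hb⟩ := max_le_iff.1 hT
    have hMT : M T = selfPowRoot T := max_eq_right h2
    refine le_max_of_le_right (le_of_lt ?_)
    rw [Nat.lt_clog_iff_pow_lt (hM T), hMT]
    exact (Nat.pow_lt_pow_right h2 hb).trans_le (selfPowRoot_pow_le hT1)

/-! ### Resampling one coordinate of an infinite product -/

section Resampling

variable {ι : Type*} [DecidableEq ι] {Ω : ι → Type*} [∀ i, MeasurableSpace (Ω i)]
  (μ : ∀ i, Measure (Ω i)) [∀ i, IsProbabilityMeasure (μ i)]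

lemma measurePreserving_update_infinitePi (t : ι) :
    MeasurePreserving (fun q : (∀ i, Ω i) × Ω t => Function.update q.1 t q.2)
      ((Measure.infinitePi μ).prod (μ t)) (Measure.infinitePi μ) := by
  refine ⟨measurable_update', Measure.eq_infinitePi _ fun s B hB => ?_⟩
  rw [Measure.map_apply measurable_update' (.pi s.countable_toSet fun i _ => hB i)]
  have hpre : (fun q : (∀ i, Ω i) × Ω t => Function.update q.1 t q.2) ⁻¹' (Set.pi s B) =
      (Set.pi (s.erase t : Finset ι) B) ×ˢ (if t ∈ s then B t else Set.univ) := by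
    ext ⟨ω, r⟩
    simp only [Set.mem_preimage, Set.mem_pi, Set.mem_prod, Finset.mem_coe, Finset.mem_erase]
    constructor
    · refine fun h => ⟨fun i hi => by simpa [hi.1] using h i hi.2, ?_⟩
      split_ifs with ht
      · simpa using h t ht
      · trivial
    · rintro ⟨hrest, ht⟩ i hi
      rcases eq_or_ne i t with rfl | hit
      · simpa [hi] using ht
      · simpa [hit] using hrest i ⟨hit, hi⟩
  rw [hpre, Measure.prod_prod, Measure.infinitePi_pi _ fun i _ => hB i]
  split_ifs with ht
  · rw [mul_comm, Finset.mul_prod_erase s (fun i => μ i (B i)) ht]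
  · simp [Finset.erase_eq_of_notMem ht]

lemma integral_infinitePi_resample {E : Type*} [NormedAddCommGroup E] [NormedSpace ℝ E] {t : ι}
    {g : (∀ i, Ω i) → Ω t → E} (hg : StronglyMeasurable fun q : (∀ i, Ω i) × Ω t => g q.1 q.2)
    (hint : Integrable (fun q : (∀ i, Ω i) × Ω t => g q.1 q.2) ((Measure.infinitePi μ).prod (μ t)))
    (hinv : ∀ ω r, g (Function.update ω t r) = g ω) :
    ∫ ω, g ω (ω t) ∂(Measure.infinitePi μ) = ∫ ω, ∫ r, g ω r ∂(μ t) ∂(Measure.infinitePi μ) := by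
  have hmp := measurePreserving_update_infinitePi μ t
  have hdiag : StronglyMeasurable fun ω : ∀ i, Ω i => g ω (ω t) :=
    hg.comp_measurable (measurable_id.prodMk (measurable_pi_apply t))
  calc ∫ ω, g ω (ω t) ∂(Measure.infinitePi μ)
      = ∫ q, g (Function.update q.1 t q.2) (Function.update q.1 t q.2 t)
          ∂((Measure.infinitePi μ).prod (μ t)) := by
        conv_lhs => rw [← hmp.map_eq]
        exact integral_map hmp.measurable.aemeasurable hdiag.aestronglyMeasurable
    _ = ∫ q, g q.1 q.2 ∂((Measure.infinitePi μ).prod (μ t)) := by simp [hinv]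
    _ = _ := integral_prod _ hint

lemma integral_infinitePi_le_of_resample {t : ι} {g : (∀ i, Ω i) → Ω t → ℝ}
    (hg : StronglyMeasurable fun q : (∀ i, Ω i) × Ω t => g q.1 q.2)
    (hint : Integrable (fun q : (∀ i, Ω i) × Ω t => g q.1 q.2) ((Measure.infinitePi μ).prod (μ t)))
    (hinv : ∀ ω r, g (Function.update ω t r) = g ω) {c : (∀ i, Ω i) → ℝ}
    (hc : Integrable c (Measure.infinitePi μ)) (hle : ∀ ω, ∫ r, g ω r ∂(μ t) ≤ c ω) :
    ∫ ω, g ω (ω t) ∂(Measure.infinitePi μ) ≤ ∫ ω, c ω ∂(Measure.infinitePi μ) := by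
  rw [integral_infinitePi_resample μ hg hint hinv]
  exact integral_mono hint.integral_prod_left hc hle

lemma infinitePi_real_resample {t : ι} {S : (∀ i, Ω i) → Set (Ω t)}
    (hS : MeasurableSet {q : (∀ i, Ω i) × Ω t | q.2 ∈ S q.1})
    (hinv : ∀ ω r, S (Function.update ω t r) = S ω) :
    (Measure.infinitePi μ).real {ω | ω t ∈ S ω} =
      ∫ ω, (μ t).real (S ω) ∂(Measure.infinitePi μ) := by
  have hm : MeasurableSet {ω : ∀ i, Ω i | ω t ∈ S ω} :=
    (measurable_id.prodMk (measurable_pi_apply t)) hS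
  have hSω : ∀ ω, MeasurableSet (S ω) := fun ω => (measurable_const.prodMk measurable_id) hS
  have hg : StronglyMeasurable fun q : (∀ i, Ω i) × Ω t => (S q.1).indicator (1 : Ω t → ℝ) q.2 :=
    (stronglyMeasurable_const (b := (1 : ℝ))).indicator hS
  have h := integral_infinitePi_resample μ (g := fun ω => (S ω).indicator 1) hg
    ((integrable_const (1 : ℝ)).indicator hS) fun ω r => by rw [hinv]
  simp only [integral_indicator_one (hSω _)] at h
  rw [← h, ← integral_indicator_one hm]
  rfl

end Resampling

/-! ### Transcripts of bandit algorithms -/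

lemma measurable_eval_fin {k : ℕ} : Measurable (fun q : (Fin k → ℝ) × Fin k => q.1 q.2) :=
  measurable_from_prod_countable_left fun a => measurable_pi_apply a

namespace BanditAlgorithm

variable {k : ℕ} {Ω : Type} [MeasurableSpace Ω] (f : BanditAlgorithm k Ω)

instance : IsProbabilityMeasure f.bitsLaw :=
  inferInstanceAs (IsProbabilityMeasure (Measure.infinitePi fun _ : ℕ => f.law))

section Transcript

variable (ℓ : (t : ℕ) → Transcript k Ω t → Fin k → ℝ)

lemma transcript_succ (ω : ℕ → Ω) (t : ℕ) :
    f.transcript ℓ ω (t + 1) = Fin.snoc (α := fun _ => Ω × Fin k × ℝ) (f.transcript ℓ ω t)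
      (ω t, f.action ℓ ω t, ℓ t (f.transcript ℓ ω t) (f.action ℓ ω t)) := rfl

lemma transcript_apply (ω : ℕ → Ω) (t : ℕ) (s : Fin t) :
    f.transcript ℓ ω t s =
      (ω s, f.action ℓ ω s, ℓ s (f.transcript ℓ ω s) (f.action ℓ ω s)) := by
  induction t with
  | zero => exact s.elim0
  | succ t ih =>
    rw [transcript_succ]
    refine Fin.lastCases ?_ (fun s => ?_) s
    · simp
    · simpa using ih s

lemma transcript_update (ω : ℕ → Ω) {t s : ℕ} (hs : s ≤ t) (r : Ω) :
    f.transcript ℓ (Function.update ω t r) s = f.transcript ℓ ω s := by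
  induction s with
  | zero => rfl
  | succ s ih =>
    have hst : s ≠ t := by omega
    simp only [transcript_succ, action, ih (by omega), Function.update_of_ne hst]

variable {ℓ}

lemma measurable_transcript (hℓ : ∀ t, Measurable (ℓ t)) (t : ℕ) :
    Measurable (fun ω => f.transcript ℓ ω t) := by
  induction t with
  | zero => exact measurable_const
  | succ t ih =>
    have hact : Measurable fun ω => f.action ℓ ω t :=
      (f.measurable_act t).comp (ih.prodMk (measurable_pi_apply t))
    refine measurable_pi_lambda _ fun s => ?_
    simp only [transcript_succ]
    refine Fin.lastCases ?_ (fun s => ?_) s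
    · simp only [Fin.snoc_last]
      exact (measurable_pi_apply t).prodMk (hact.prodMk
        (measurable_eval_fin.comp (((hℓ t).comp ih).prodMk hact)))
    · simp only [Fin.snoc_castSucc]
      exact (measurable_pi_apply s).comp ih

lemma measurable_action (hℓ : ∀ t, Measurable (ℓ t)) (t : ℕ) :
    Measurable (fun ω => f.action ℓ ω t) :=
  (f.measurable_act t).comp ((f.measurable_transcript hℓ t).prodMk (measurable_pi_apply t))

end Transcript

lemma bitsLaw_real_act_eq_integral {t : ℕ} {Φ : (ℕ → Ω) → Transcript k Ω t} (hΦ : Measurable Φ)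
    (hinv : ∀ ω r, Φ (Function.update ω t r) = Φ ω) (i : Fin k) :
    f.bitsLaw.real {ω | f.act t (Φ ω) (ω t) = i} =
      ∫ ω, f.law.real {r | f.act t (Φ ω) r = i} ∂f.bitsLaw := by
  have hact : Measurable fun q : (ℕ → Ω) × Ω => f.act t (Φ q.1) q.2 :=
    (f.measurable_act t).comp ((hΦ.comp measurable_fst).prodMk measurable_snd)
  exact infinitePi_real_resample (fun _ => f.law) (S := fun ω => {r | f.act t (Φ ω) r = i})
    (hact (measurableSet_singleton i)) fun ω r => by rw [hinv]

lemma bitsLaw_real_act_le {t : ℕ} {Φ Φ' : (ℕ → Ω) → Transcript k Ω t} (hΦ : Measurable Φ)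
    (hΦ' : Measurable Φ') (hinv : ∀ ω r, Φ (Function.update ω t r) = Φ ω)
    (hinv' : ∀ ω r, Φ' (Function.update ω t r) = Φ' ω) {i : Fin k}
    (h : ∀ ω, f.law.real {r | f.act t (Φ ω) r = i} ≤ f.law.real {r | f.act t (Φ' ω) r = i}) :
    f.bitsLaw.real {ω | f.act t (Φ ω) (ω t) = i} ≤
      f.bitsLaw.real {ω | f.act t (Φ' ω) (ω t) = i} := by
  have hint : ∀ Ψ : (ℕ → Ω) → Transcript k Ω t, Measurable Ψ →
      Integrable (fun ω => f.law.real {r | f.act t (Ψ ω) r = i}) f.bitsLaw := fun Ψ hΨ => by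
    have hact : Measurable fun q : (ℕ → Ω) × Ω => f.act t (Ψ q.1) q.2 :=
      (f.measurable_act t).comp ((hΨ.comp measurable_fst).prodMk measurable_snd)
    exact .of_bound (measurable_measure_prodMk_left
      (hact (measurableSet_singleton i))).ennreal_toReal.aestronglyMeasurable 1
      (.of_forall fun ω => by simp [abs_of_nonneg measureReal_nonneg, measureReal_le_one])
  rw [f.bitsLaw_real_act_eq_integral hΦ hinv, f.bitsLaw_real_act_eq_integral hΦ' hinv']
  exact integral_mono (hint Φ hΦ) (hint Φ' hΦ') h

end BanditAlgorithm

/-! ### The law of a round of MonoBandit -/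

section Sampling

variable {k : ℕ}

instance [NeZero k] (ε : unitInterval) : IsProbabilityMeasure (coinLaw k ε) :=
  isProbabilityMeasure_coinLaw k ε

lemma integral_coinLaw (ε : unitInterval) (h : Coin k → ℝ) :
    ∫ c, h c ∂(coinLaw k ε) =
      (1 - ε) * h .exploit + ε * (uniformDist k ⬝ᵥ fun i => h (.explore i)) := by
  have hexploit : (0 : ℝ) ≤ 1 - ε := sub_nonneg.2 ε.2.2
  have hexplore : (0 : ℝ) ≤ ε / k := div_nonneg ε.2.1 (Nat.cast_nonneg k)
  have hint : ∀ (c : Coin k) (x : ℝ),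
      Integrable h (ENNReal.ofReal x • Measure.dirac c) := fun c x =>
    (integrable_dirac (by simp)).smul_measure ENNReal.ofReal_ne_top
  rw [coinLaw, integral_add_measure (hint _ _) (integrable_finsetSum_measure.2 fun i _ => hint _ _),
    integral_finsetSum_measure fun i _ => hint _ _]
  simp only [integral_smul_measure, integral_dirac, ENNReal.toReal_ofReal, hexploit, hexplore,
    smul_eq_mul, dotProduct, uniformDist, Finset.mul_sum]
  exact congrArg _ (Finset.sum_congr rfl fun i _ => by ring)

variable [NeZero k] {p : Fin k → ℝ}

lemma measurable_sampleAction_right (p : Fin k → ℝ) : Measurable (sampleAction p) :=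
  measurable_sampleAction.comp (measurable_const.prodMk measurable_id)

lemma sampleAction_le_iff (hp : p ∈ stdSimplex ℝ (Fin k)) (u : unitInterval) (i : Fin k) :
    sampleAction p u ≤ i ↔ (u : ℝ) ≤ ∑ j ∈ Finset.Iic i, p j := by
  have hne : (Finset.univ.filter fun i : Fin k => (u : ℝ) ≤ ∑ j ∈ Finset.Iic i, p j).Nonempty :=
    ⟨⊤, by simpa [hp.2] using u.2.2⟩
  simp only [sampleAction, hne, dif_pos]
  refine ⟨fun h => (Finset.mem_filter.1 (Finset.min'_mem _ hne)).2.trans ?_,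
    fun h => Finset.min'_le _ _ (by simpa using h)⟩
  exact Finset.sum_le_sum_of_subset_of_nonneg (Finset.Iic_subset_Iic.2 h) fun a _ _ => hp.1 a

lemma volume_real_sampleAction_le (hp : p ∈ stdSimplex ℝ (Fin k)) (i : Fin k) :
    (volume : Measure unitInterval).real {u | sampleAction p u ≤ i} = ∑ j ∈ Finset.Iic i, p j := by
  have h0 : 0 ≤ ∑ j ∈ Finset.Iic i, p j := Finset.sum_nonneg fun j _ => hp.1 j
  have h1 : ∑ j ∈ Finset.Iic i, p j ≤ 1 := hp.2 ▸
    Finset.sum_le_sum_of_subset_of_nonneg (Finset.subset_univ _) fun j _ _ => hp.1 j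
  have hset : {u | sampleAction p u ≤ i} =
      Set.Iic (⟨∑ j ∈ Finset.Iic i, p j, h0, h1⟩ : unitInterval) :=
    Set.ext fun u => sampleAction_le_iff hp u i
  rw [hset, measureReal_def, unitInterval.volume_Iic, ENNReal.toReal_ofReal h0]

lemma volume_real_sampleAction_eq (hp : p ∈ stdSimplex ℝ (Fin k)) (i : Fin k) :
    (volume : Measure unitInterval).real {u | sampleAction p u = i} = p i := by
  have hcum : ∀ i : Fin k, ∑ j ∈ Finset.Iic i,
      (volume : Measure unitInterval).real {u | sampleAction p u = j} =
        ∑ j ∈ Finset.Iic i, p j := by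
    intro i
    rw [← volume_real_sampleAction_le hp i]
    have hmeas : ∀ j, MeasurableSet {u | sampleAction p u = j} := fun j =>
      measurable_sampleAction_right p (measurableSet_singleton j)
    refine (measureReal_biUnion_finset (fun a _ b _ hab => Set.disjoint_left.2
      fun u hu hu' => hab (hu.symm.trans hu')) fun j _ => hmeas j).symm.trans (congrArg _ ?_)
    ext u
    simp
  induction i using WellFoundedLT.induction with
  | ind i ih =>
    have hi := hcum i
    rw [← Finset.Iio_insert, Finset.sum_insert (by simp), Finset.sum_insert (by simp),
      Finset.sum_congr rfl fun j hj => ih j (Finset.mem_Iio.1 hj)] at hi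
    exact add_right_cancel hi

lemma integral_sampleAction (hp : p ∈ stdSimplex ℝ (Fin k)) (h : Fin k → ℝ) :
    ∫ u, h (sampleAction p u) = p ⬝ᵥ h := by
  have hm := measurable_sampleAction_right p
  have : IsProbabilityMeasure ((volume : Measure unitInterval).map (sampleAction p)) :=
    Measure.isProbabilityMeasure_map hm.aemeasurable
  rw [← integral_map (f := h) hm.aemeasurable (measurable_of_finite h).aestronglyMeasurable,
    integral_fintype Integrable.of_finite]
  refine Finset.sum_congr rfl fun a _ => ?_
  rw [map_measureReal_apply hm (measurableSet_singleton a), smul_eq_mul]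
  exact congrArg (· * h a) (volume_real_sampleAction_eq hp a)

lemma integral_coinAction (hp : p ∈ stdSimplex ℝ (Fin k)) (ε : unitInterval)
    (h : Coin k → Fin k → ℝ) :
    ∫ r, h r.1 (coinAction p r.2 r.1) ∂(coinLaw k ε).prod (volume : Measure unitInterval) =
      (1 - ε) * (p ⬝ᵥ h .exploit) + ε * (uniformDist k ⬝ᵥ fun i => h (.explore i) i) := by
  have hm : Measurable fun r : Coin k × unitInterval => h r.1 (coinAction p r.2 r.1) :=
    (measurable_of_finite fun q : Coin k × Fin k => h q.1 q.2).comp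
      (measurable_fst.prodMk (measurable_coinAction.comp
        (measurable_fst.prodMk (measurable_const.prodMk measurable_snd))))
  obtain ⟨C, hC⟩ := (Set.finite_range fun q : Coin k × Fin k => |h q.1 q.2|).bddAbove
  rw [integral_prod _ (Integrable.of_bound hm.aestronglyMeasurable C
    (.of_forall fun r => hC ⟨(r.1, _), rfl⟩)), integral_coinLaw]
  simp [coinAction, integral_sampleAction hp (h .exploit)]

lemma law_real_coinAction (hp : p ∈ stdSimplex ℝ (Fin k)) (ε : unitInterval) (i : Fin k) :
    ((coinLaw k ε).prod (volume : Measure unitInterval)).real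
      {r | coinAction p r.2 r.1 = i} = (1 - ε) * p i + ε * uniformDist k i := by
  have hm : MeasurableSet {r : Coin k × unitInterval | coinAction p r.2 r.1 = i} :=
    (measurable_coinAction.comp (measurable_fst.prodMk (measurable_const.prodMk measurable_snd)))
      (measurableSet_singleton i)
  have h := integral_coinAction hp ε fun _ => Pi.single i 1
  rw [dotProduct_single_one, dotProduct_single_one] at h
  rw [← h, ← integral_indicator_one hm]
  exact integral_congr_ae (.of_forall fun r => by simp [Set.indicator_apply, Pi.single_apply])

end Sampling

/-! ### Inverse-propensity-weighted losses -/

/-- The sampled loss vector of a round of MonoBandit in which the coin showed `c` and the loss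
vector was `v`: the inverse-propensity-weighted estimate of `v`. -/
noncomputable def coinLoss {k : ℕ} (ε : ℝ) (v : Fin k → ℝ) (c : Coin k) (a : Fin k) : ℝ :=
  if c = .explore a then k * v a / ε else 0

section CoinLoss

variable {k : ℕ}

lemma measurable_coinLoss (ε : ℝ) :
    Measurable fun q : (Fin k → ℝ) × Coin k => coinLoss ε q.1 q.2 := by
  refine measurable_from_prod_countable_left fun c => measurable_pi_lambda _ fun a => ?_
  by_cases hc : c = .explore a
  · simp only [coinLoss, hc, if_true]
    fun_prop
  · simp only [coinLoss, hc, if_false]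
    exact measurable_const

lemma lowersAt_coinLoss {ε : ℝ} (hε : 0 ≤ ε) {v' v : Fin k → ℝ} {i : Fin k}
    (h : LowersAt i v' v) (c : Coin k) : LowersAt i (coinLoss ε v' c) (coinLoss ε v c) := by
  refine ⟨?_, fun a ha => by simp only [coinLoss, h.2 a ha]⟩
  have hi := h.1
  unfold coinLoss
  split_ifs
  · gcongr
  · exact le_rfl

lemma coinLoss_mem_Icc {ε : ℝ} (hε : 0 ≤ ε) {v : Fin k → ℝ} (hv : ∀ a, v a ∈ Set.Icc (0 : ℝ) 1)
    (c : Coin k) (a : Fin k) : coinLoss ε v c a ∈ Set.Icc 0 (k / ε) := by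
  have h0 := (hv a).1
  unfold coinLoss
  split_ifs
  · exact ⟨by positivity, by gcongr; exact mul_le_of_le_one_right (by positivity) (hv a).2⟩
  · exact ⟨le_rfl, by positivity⟩

lemma sampledLoss_eq_coinLoss (ε : ℝ) (c : Coin k) (a : Fin k) (b : ℝ) :
    sampledLoss ε c a b = coinLoss ε (Pi.single a b) c := by
  ext j
  cases c with
  | exploit => simp [sampledLoss, coinLoss]
  | explore i =>
    rcases eq_or_ne i j with rfl | hij
    · rcases eq_or_ne a i with rfl | hai <;> simp [sampledLoss, coinLoss, *]
    · rcases eq_or_ne a i with rfl | hai <;> simp [sampledLoss, coinLoss, *, hij.symm]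

variable [NeZero k]

lemma sampledLoss_coinAction (ε : ℝ) (v p : Fin k → ℝ) (u : unitInterval) (c : Coin k) :
    sampledLoss ε c (coinAction p u c) (v (coinAction p u c)) = coinLoss ε v c := by
  ext j
  cases c with
  | exploit => simp [sampledLoss, coinLoss]
  | explore i => rcases eq_or_ne i j with rfl | hij <;> simp [sampledLoss, coinAction, coinLoss, *,
      Ne.symm]

lemma integral_coinLoss {ε : unitInterval} (hε : 0 < ε) (v : Fin k → ℝ) (a : Fin k) :
    ∫ c, coinLoss ε v c a ∂(coinLaw k ε) = v a := by
  have hε' : (ε : ℝ) ≠ 0 := (show (0 : ℝ) < ε from hε).ne'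
  have hk : (k : ℝ) ≠ 0 := by exact_mod_cast NeZero.ne k
  rw [integral_coinLaw]
  simp [coinLoss, dotProduct, uniformDist]
  field_simp [hε', hk]

end CoinLoss

/-! ### Monotonicity of MonoBandit -/

section Monotonicity

variable {k t : ℕ} {S : Type}

/-- The loss vectors that MonoBandit passes to its full-feedback algorithm in the rounds of the
transcript `φ`. -/
noncomputable def sampledHistory (ε : ℝ) (φ : Transcript k (Coin k × S) t) (s : Fin t) :
    Fin k → ℝ :=
  sampledLoss ε (φ s).1.1 (φ s).2.1 (φ s).2.2

lemma sampledHistory_mem_Icc {ε : ℝ} (hε : 0 ≤ ε) {φ : Transcript k (Coin k × S) t}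
    (hφ : ∀ s, (φ s).2.2 ∈ Set.Icc (0 : ℝ) 1) (s : Fin t) (a : Fin k) :
    sampledHistory ε φ s a ∈ Set.Icc 0 (k / ε) := by
  rw [sampledHistory, sampledLoss_eq_coinLoss]
  refine coinLoss_mem_Icc hε (fun j => ?_) _ _
  rw [Pi.single_apply]
  split_ifs
  · exact hφ s
  · exact ⟨le_rfl, zero_le_one⟩

lemma exploitDist_mem [NeZero k] (ε : ℝ) (A : FullAlgorithm k) (φ : Transcript k (Coin k × S) t) :
    exploitDist ε A t φ ∈ stdSimplex ℝ (Fin k) := by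
  unfold exploitDist
  split_ifs
  · exact uniformDist_mem k
  · exact A.prob_mem _ _

lemma exploitDist_rescale_le [NeZero k] {ε : ℝ} (hε : 0 < ε) {A : FullAlgorithm k}
    (hA : A.IsMonotone) {φ' φ : Transcript k (Coin k × S) t} {i : Fin k}
    (hφ' : ∀ s, (φ' s).2.2 ∈ Set.Icc (0 : ℝ) 1) (hφ : ∀ s, (φ s).2.2 ∈ Set.Icc (0 : ℝ) 1)
    (h : ∀ s, LowersAt i (sampledHistory ε φ' s) (sampledHistory ε φ s)) :
    exploitDist ε (A.rescale (k / ε)) t φ i ≤ exploitDist ε (A.rescale (k / ε)) t φ' i := by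
  have hk : (0 : ℝ) < k := by exact_mod_cast Nat.pos_of_ne_zero (NeZero.ne k)
  unfold exploitDist
  split_ifs
  · exact le_rfl
  · exact hA.rescale_prob_le (div_pos hk hε) (sampledHistory_mem_Icc hε.le hφ')
      (sampledHistory_mem_Icc hε.le hφ) h

variable [NeZero k] {ε : unitInterval} {A : FullAlgorithm k}

lemma monoBandit_bitsLaw_real_act_le (hε : 0 < ε) (hA : A.IsMonotone)
    {Φ Φ' : (ℕ → Coin k × unitInterval) → Transcript k (Coin k × unitInterval) t}
    (hΦ : Measurable Φ) (hΦ' : Measurable Φ') (hinv : ∀ ω r, Φ (Function.update ω t r) = Φ ω)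
    (hinv' : ∀ ω r, Φ' (Function.update ω t r) = Φ' ω)
    (hmem : ∀ ω s, (Φ ω s).2.2 ∈ Set.Icc (0 : ℝ) 1)
    (hmem' : ∀ ω s, (Φ' ω s).2.2 ∈ Set.Icc (0 : ℝ) 1) {i : Fin k}
    (h : ∀ ω s, LowersAt i (sampledHistory ε (Φ' ω) s) (sampledHistory ε (Φ ω) s)) :
    let f := monoBandit ε (A.rescale (k / ε))
    f.bitsLaw.real {ω | f.act t (Φ ω) (ω t) = i} ≤
      f.bitsLaw.real {ω | f.act t (Φ' ω) (ω t) = i} := by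
  refine BanditAlgorithm.bitsLaw_real_act_le _ hΦ hΦ' hinv hinv' fun ω => ?_
  have hle := exploitDist_rescale_le (show (0 : ℝ) < ε from hε) hA (hmem' ω) (hmem ω) (h ω)
  calc _ = (1 - ε) * exploitDist ε (A.rescale (k / ε)) t (Φ ω) i + ε * uniformDist k i :=
        law_real_coinAction (exploitDist_mem _ _ _) ε i
    _ ≤ (1 - ε) * exploitDist ε (A.rescale (k / ε)) t (Φ' ω) i + ε * uniformDist k i := by
        gcongr
        exact sub_nonneg.2 ε.2.2
    _ = _ := (law_real_coinAction (exploitDist_mem _ _ _) ε i).symm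

lemma monoBandit_isMonotone (hε : 0 < ε) (hA : A.IsMonotone) :
    (monoBandit ε (A.rescale (k / ε))).IsMonotone := by
  intro t π hπ s x hx hxs
  set π' := Function.update π s ((π s).1, x)
  have hπ' : ∀ r, (π' r).2 ∈ Set.Icc (0 : ℝ) 1 := fun r => by
    rcases eq_or_ne r s with rfl | hr
    · simpa [π'] using ⟨hx, hxs.trans (hπ r).2⟩
    · simpa [π', hr] using hπ r
  have hmeas : ∀ π : Fin t → Fin k × ℝ,
      Measurable fun (ω : ℕ → Coin k × unitInterval) (s : Fin t) => (ω s, π s) := fun π =>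
    measurable_pi_lambda _ fun s => (measurable_pi_apply _).prodMk measurable_const
  have hinv : ∀ (π : Fin t → Fin k × ℝ) (ω : ℕ → Coin k × unitInterval)
      (r : Coin k × unitInterval),
      (fun s : Fin t => (Function.update ω t r s, π s)) = fun s : Fin t => (ω s, π s) :=
    fun π ω r => funext fun s => by rw [Function.update_of_ne s.2.ne]
  refine monoBandit_bitsLaw_real_act_le hε hA (hmeas π) (hmeas π') (hinv π) (hinv π')
    (fun _ => hπ) (fun _ => hπ') fun ω r => ?_
  rcases eq_or_ne r s with rfl | hr
  · simp only [sampledHistory, sampledLoss_eq_coinLoss, π', Function.update_self]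
    refine lowersAt_coinLoss ε.2.1 ⟨by simpa using hxs, fun a ha => ?_⟩ _
    simp [ha]
  · simpa [sampledHistory, π', hr] using LowersAt.refl _ _

lemma sampledHistory_transcript (ε : unitInterval) (A : FullAlgorithm k)
    (ℓ : (t : ℕ) → Transcript k (Coin k × unitInterval) t → Fin k → ℝ)
    (ω : ℕ → Coin k × unitInterval) (s : Fin t) :
    sampledHistory ε ((monoBandit ε A).transcript ℓ ω t) s =
      coinLoss ε (ℓ s ((monoBandit ε A).transcript ℓ ω s)) (ω s).1 := by
  rw [sampledHistory, BanditAlgorithm.transcript_apply]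
  exact sampledLoss_coinAction _ _ _ _ _

lemma monoBandit_isLossMonotone (hε : 0 < ε) (hA : A.IsMonotone) :
    (monoBandit ε (A.rescale (k / ε))).IsLossMonotone := by
  intro l hl s i x hx hxs t _
  set f := monoBandit ε (A.rescale (k / ε))
  set l' := Function.update l s (Function.update (l s) i x)
  have hl' : ∀ r a, l' r a ∈ Set.Icc (0 : ℝ) 1 :=
    update_update_apply_mem hl ⟨hx, hxs.trans (hl s i).2⟩
  have hmeas : ∀ l : ℕ → Fin k → ℝ, Measurable fun ω => f.transcript (fun r _ => l r) ω t :=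
    fun l => f.measurable_transcript (fun _ => measurable_const) t
  have hmem : ∀ l : ℕ → Fin k → ℝ, (∀ r a, l r a ∈ Set.Icc (0 : ℝ) 1) →
      ∀ ω (r : Fin t), (f.transcript (fun r _ => l r) ω t r).2.2 ∈ Set.Icc (0 : ℝ) 1 :=
    fun l hl ω r => by
      rw [f.transcript_apply]
      exact hl _ _
  refine monoBandit_bitsLaw_real_act_le hε hA (hmeas l) (hmeas l')
    (fun ω r => f.transcript_update _ ω le_rfl r) (fun ω r => f.transcript_update _ ω le_rfl r)
    (hmem l hl) (hmem l' hl') fun ω r => ?_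
  rw [sampledHistory_transcript, sampledHistory_transcript]
  exact lowersAt_coinLoss ε.2.1 (LowersAt.update_apply hxs r) _

end Monotonicity

/-! ### Swap regret of MonoBandit -/

section Swap

variable {k : ℕ} {B : ℝ}

lemma abs_dotProduct_sub_comp_le {p v : Fin k → ℝ} (hp : p ∈ stdSimplex ℝ (Fin k))
    (hv : ∀ a, v a ∈ Set.Icc 0 B) (χ : Fin k → Fin k) : |p ⬝ᵥ (v - v ∘ χ)| ≤ B := by
  refine abs_le.2 (dotProduct_mem_of_mem_stdSimplex hp (convex_Icc (-B) B) fun a => abs_le.1 ?_)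
  simpa [Real.dist_eq] using Real.dist_le_of_mem_Icc (hv a) (hv (χ a))

variable {Ω : Type*} [MeasurableSpace Ω] {p v : Ω → Fin k → ℝ}

lemma measurable_dotProduct_sub_comp (hp : Measurable p) (hv : Measurable v) (χ : Fin k → Fin k) :
    Measurable fun ω => p ω ⬝ᵥ (v ω - v ω ∘ χ) :=
  Finset.measurable_sum _ fun a _ => ((measurable_pi_apply a).comp hp).mul
    (((measurable_pi_apply a).comp hv).sub ((measurable_pi_apply (χ a)).comp hv))

lemma integrable_dotProduct_sub_comp {μ : Measure Ω} [IsFiniteMeasure μ] (hp : Measurable p)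
    (hv : Measurable v) (hpmem : ∀ ω, p ω ∈ stdSimplex ℝ (Fin k))
    (hvmem : ∀ ω a, v ω a ∈ Set.Icc 0 B) (χ : Fin k → Fin k) :
    Integrable (fun ω => p ω ⬝ᵥ (v ω - v ω ∘ χ)) μ :=
  .of_bound (measurable_dotProduct_sub_comp hp hv χ).aestronglyMeasurable B
    (.of_forall fun ω => abs_dotProduct_sub_comp_le (hpmem ω) (hvmem ω) χ)

lemma FullAlgorithm.HasSwapRegretLE.mixedSwapRegret_rescale_le {A : FullAlgorithm k} {T : ℕ} {S : ℝ}
    (hS : A.HasSwapRegretLE T S) (hB : 0 < B) {L : ℕ → Fin k → ℝ}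
    (hL : ∀ t a, L t a ∈ Set.Icc 0 B) (χ : Fin k → Fin k) :
    mixedSwapRegret ((A.rescale B).play L) L T χ ≤ B * S := by
  let L' : ℕ → Fin k → ℝ := fun t a => L t a / B
  have hL' : ∀ t a, L' t a ∈ Set.Icc (0 : ℝ) 1 := fun t a =>
    ⟨div_nonneg (hL t a).1 hB.le, (div_le_one hB).2 (hL t a).2⟩
  have hLB : ∀ t, L t = B • L' t := fun t =>
    funext fun a => (mul_div_cancel₀ (L t a) hB.ne').symm
  calc mixedSwapRegret ((A.rescale B).play L) L T χ = B * mixedSwapRegret (A.play L') L' T χ := by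
        have hplay : (A.rescale B).play L = A.play L' := rfl
        simp only [mixedSwapRegret, hplay, hLB, Pi.smul_comp, ← smul_sub, dotProduct_smul,
          smul_eq_mul, Finset.mul_sum]
    _ ≤ B * S := mul_le_mul_of_nonneg_left (hS L' hL' χ) hB.le

end Swap

namespace BanditAlgorithm

variable {k : ℕ} {Ω : Type} [MeasurableSpace Ω] (f : BanditAlgorithm k Ω) (ℓ : Adversary k Ω)

/-- The loss vector that the adversary chooses in round `t`. -/
def lossVec (ω : ℕ → Ω) (t : ℕ) : Fin k → ℝ :=
  ℓ.loss t (f.transcript ℓ.loss ω t)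

lemma measurable_lossVec (t : ℕ) : Measurable fun ω => f.lossVec ℓ ω t :=
  (ℓ.measurable_loss t).comp (f.measurable_transcript ℓ.measurable_loss t)

lemma lossVec_mem_Icc (ω : ℕ → Ω) (t : ℕ) (a : Fin k) : f.lossVec ℓ ω t a ∈ Set.Icc (0 : ℝ) 1 :=
  ℓ.loss_mem _ _ _

lemma lossVec_update (ω : ℕ → Ω) {s t : ℕ} (hs : s ≤ t) (r : Ω) :
    f.lossVec ℓ (Function.update ω t r) s = f.lossVec ℓ ω s :=
  congrArg (ℓ.loss s) (f.transcript_update _ ω hs r)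

/-- The instantaneous swap regret of round `t` for the swap function `χ`. -/
def instSwapRegret (χ : Fin k → Fin k) (t : ℕ) (ω : ℕ → Ω) : ℝ :=
  (f.lossVec ℓ ω t - f.lossVec ℓ ω t ∘ χ) (f.action ℓ.loss ω t)

lemma swapRegret_eq_iSup_integral (T : ℕ) :
    f.swapRegret ℓ T =
      ⨆ χ, ∫ ω, ∑ t ∈ Finset.range T, f.instSwapRegret ℓ χ t ω ∂f.bitsLaw := rfl

lemma abs_lossVec_sub_comp_le (χ : Fin k → Fin k) (t : ℕ) (ω : ℕ → Ω) (a : Fin k) :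
    |(f.lossVec ℓ ω t - f.lossVec ℓ ω t ∘ χ) a| ≤ 1 := by
  simpa [Real.dist_eq] using
    Real.dist_le_of_mem_Icc (f.lossVec_mem_Icc ℓ ω t a) (f.lossVec_mem_Icc ℓ ω t (χ a))

lemma measurable_lossVec_sub_comp (χ : Fin k → Fin k) (t : ℕ) :
    Measurable fun ω => f.lossVec ℓ ω t - f.lossVec ℓ ω t ∘ χ :=
  (f.measurable_lossVec ℓ t).sub (measurable_pi_lambda _ fun a =>
    (measurable_pi_apply (χ a)).comp (f.measurable_lossVec ℓ t))

lemma integrable_instSwapRegret (χ : Fin k → Fin k) (t : ℕ) :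
    Integrable (f.instSwapRegret ℓ χ t) f.bitsLaw :=
  .of_bound (measurable_eval_fin.comp ((f.measurable_lossVec_sub_comp ℓ χ t).prodMk
    (f.measurable_action ℓ.measurable_loss t))).aestronglyMeasurable 1
    (.of_forall fun ω => f.abs_lossVec_sub_comp_le ℓ χ t ω _)

lemma integral_instSwapRegret_le {χ : Fin k → Fin k} {t : ℕ} {c : (ℕ → Ω) → ℝ}
    (hc : Integrable c f.bitsLaw)
    (hle : ∀ ω, ∫ r, (f.lossVec ℓ ω t - f.lossVec ℓ ω t ∘ χ)
      (f.act t (f.transcript ℓ.loss ω t) r) ∂f.law ≤ c ω) :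
    ∫ ω, f.instSwapRegret ℓ χ t ω ∂f.bitsLaw ≤ ∫ ω, c ω ∂f.bitsLaw := by
  have hm : Measurable fun q : (ℕ → Ω) × Ω => (f.lossVec ℓ q.1 t - f.lossVec ℓ q.1 t ∘ χ)
      (f.act t (f.transcript ℓ.loss q.1 t) q.2) :=
    measurable_eval_fin.comp (((f.measurable_lossVec_sub_comp ℓ χ t).comp measurable_fst).prodMk
      ((f.measurable_act t).comp (((f.measurable_transcript ℓ.measurable_loss t).comp
        measurable_fst).prodMk measurable_snd)))
  refine integral_infinitePi_le_of_resample (fun _ => f.law)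
    (g := fun ω r => (f.lossVec ℓ ω t - f.lossVec ℓ ω t ∘ χ)
      (f.act t (f.transcript ℓ.loss ω t) r)) hm.stronglyMeasurable
    (.of_bound hm.aestronglyMeasurable 1 (.of_forall fun q =>
      f.abs_lossVec_sub_comp_le ℓ χ t q.1 _)) (fun ω r => ?_) hc hle
  simp only [f.lossVec_update ℓ ω le_rfl, f.transcript_update _ ω le_rfl]

lemma swapRegret_nonneg (T : ℕ) : 0 ≤ f.swapRegret ℓ T := by
  refine le_ciSup_of_le (Set.finite_range _).bddAbove id ?_
  simp

lemma swapRegret_le [NeZero k] (T : ℕ) : f.swapRegret ℓ T ≤ T := by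
  rw [swapRegret_eq_iSup_integral]
  refine ciSup_le fun χ => ?_
  calc _ ≤ ∫ _, (T : ℝ) ∂f.bitsLaw := by
        refine integral_mono (integrable_finsetSum _ fun t _ => f.integrable_instSwapRegret ℓ χ t)
          (integrable_const _) fun ω => ?_
        refine (Finset.sum_le_card_nsmul (Finset.range T) _ 1 fun t _ =>
          (abs_le.1 (f.abs_lossVec_sub_comp_le ℓ χ t ω (f.action ℓ.loss ω t))).2).trans_eq ?_
        simp
    _ = T := by simp

end BanditAlgorithm

section Regret

variable {k : ℕ} [NeZero k] {ε : unitInterval} (A : FullAlgorithm k)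
  (ℓ : Adversary k (Coin k × unitInterval)) (χ : Fin k → Fin k) (t : ℕ)

lemma integral_coinAction_sub_comp_le {p v : Fin k → ℝ} (hp : p ∈ stdSimplex ℝ (Fin k))
    (hv : ∀ a, v a ∈ Set.Icc (0 : ℝ) 1) :
    ∫ r, (v - v ∘ χ) (coinAction p r.2 r.1) ∂(coinLaw k ε).prod (volume : Measure unitInterval) ≤
      p ⬝ᵥ (v - v ∘ χ) + 2 * ε := by
  rw [integral_coinAction hp ε fun _ => v - v ∘ χ]
  have hexplore := (abs_le.1 (abs_dotProduct_sub_comp_le (uniformDist_mem k) hv χ)).2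
  have hexploit := (abs_le.1 (abs_dotProduct_sub_comp_le hp hv χ)).1
  have hsum : ε * (uniformDist k ⬝ᵥ (v - v ∘ χ) - p ⬝ᵥ (v - v ∘ χ)) ≤ ε * 2 :=
    mul_le_mul_of_nonneg_left (by linarith) ε.2.1
  linarith

lemma integral_dotProduct_coinLoss (hε : 0 < ε) (q v : Fin k → ℝ) :
    ∫ r, q ⬝ᵥ (coinLoss ε v r.1 - coinLoss ε v r.1 ∘ χ)
      ∂(coinLaw k ε).prod (volume : Measure unitInterval) = q ⬝ᵥ (v - v ∘ χ) := by
  rw [integral_fun_fst fun c => q ⬝ᵥ (coinLoss ε v c - coinLoss ε v c ∘ χ)]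
  simp only [dotProduct, Pi.sub_apply, Function.comp_apply]
  rw [integral_finsetSum _ fun a _ => .of_finite]
  simp only [integral_const_mul, integral_sub Integrable.of_finite Integrable.of_finite,
    integral_coinLoss hε, probReal_univ, one_smul]

variable (ε) in
/-- The loss vector that MonoBandit, playing against `ℓ`, passes to its full-feedback algorithm in
round `t`. -/
noncomputable def runLoss (ω : ℕ → Coin k × unitInterval) (t : ℕ) : Fin k → ℝ :=
  coinLoss ε ((monoBandit ε A).lossVec ℓ ω t) (ω t).1

lemma measurable_runLoss : Measurable fun ω => runLoss ε A ℓ ω t :=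
  (measurable_coinLoss (ε : ℝ)).comp (((monoBandit ε A).measurable_lossVec ℓ t).prodMk
    (measurable_fst.comp (measurable_pi_apply t)))

lemma runLoss_mem_Icc (ω : ℕ → Coin k × unitInterval) (a : Fin k) :
    runLoss ε A ℓ ω t a ∈ Set.Icc (0 : ℝ) (k / ε) :=
  coinLoss_mem_Icc ε.2.1 ((monoBandit ε A).lossVec_mem_Icc ℓ ω t) _ a

lemma runLoss_update (ω : ℕ → Coin k × unitInterval) {s : ℕ} (hs : s < t)
    (r : Coin k × unitInterval) : runLoss ε A ℓ (Function.update ω t r) s = runLoss ε A ℓ ω s := by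
  simp only [runLoss, (monoBandit ε A).lossVec_update ℓ ω hs.le, Function.update_of_ne hs.ne]

lemma measurable_play_runLoss : Measurable fun ω => A.play (runLoss ε A ℓ ω) t :=
  (A.measurable_prob t).comp (measurable_pi_lambda _ fun s => measurable_runLoss A ℓ s)

lemma exploitDist_transcript {t : ℕ} (ht : t ≠ 0) (ω : ℕ → Coin k × unitInterval) :
    exploitDist ε A t ((monoBandit ε A).transcript ℓ.loss ω t) = A.play (runLoss ε A ℓ ω) t := by
  rw [exploitDist, if_neg ht]
  exact congrArg (A.prob t) (funext fun s => sampledHistory_transcript ε A ℓ.loss ω s)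

lemma integral_dotProduct_runLoss (hε : 0 < ε) {q : (ℕ → Coin k × unitInterval) → Fin k → ℝ}
    (hq : Measurable q) (hmem : ∀ ω, q ω ∈ stdSimplex ℝ (Fin k))
    (hinv : ∀ ω r, q (Function.update ω t r) = q ω) :
    let f := monoBandit ε A
    ∫ ω, q ω ⬝ᵥ (runLoss ε A ℓ ω t - runLoss ε A ℓ ω t ∘ χ) ∂f.bitsLaw =
      ∫ ω, q ω ⬝ᵥ (f.lossVec ℓ ω t - f.lossVec ℓ ω t ∘ χ) ∂f.bitsLaw := by
  intro f
  have hq' : Measurable fun x : (ℕ → Coin k × unitInterval) × (Coin k × unitInterval) => q x.1 :=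
    hq.comp measurable_fst
  have hm : Measurable fun x : (ℕ → Coin k × unitInterval) × (Coin k × unitInterval) =>
      coinLoss ε (f.lossVec ℓ x.1 t) x.2.1 :=
    (measurable_coinLoss (ε : ℝ)).comp (((f.measurable_lossVec ℓ t).comp measurable_fst).prodMk
      (measurable_fst.comp measurable_snd))
  refine (integral_infinitePi_resample (fun _ => f.law) (t := t) (g := fun ω r => q ω ⬝ᵥ
    (coinLoss ε (f.lossVec ℓ ω t) r.1 - coinLoss ε (f.lossVec ℓ ω t) r.1 ∘ χ))
    (measurable_dotProduct_sub_comp hq' hm χ).stronglyMeasurable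
    (integrable_dotProduct_sub_comp hq' hm (fun x => hmem x.1) (fun x =>
      coinLoss_mem_Icc ε.2.1 (f.lossVec_mem_Icc ℓ x.1 t) x.2.1) χ) fun ω r => ?_).trans ?_
  · simp only [hinv, f.lossVec_update ℓ ω le_rfl]
  · exact integral_congr_ae (.of_forall fun ω => integral_dotProduct_coinLoss χ hε _ _)

lemma integral_instSwapRegret_monoBandit_le (hε : 0 < ε) :
    let f := monoBandit ε A
    ∫ ω, f.instSwapRegret ℓ χ t ω ∂f.bitsLaw ≤
      ∫ ω, A.play (runLoss ε A ℓ ω) t ⬝ᵥ (runLoss ε A ℓ ω t - runLoss ε A ℓ ω t ∘ χ) ∂f.bitsLaw +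
        (2 * ε + if t = 0 then 2 else 0) := by
  intro f
  have hplay : ∀ ω r, A.play (runLoss ε A ℓ (Function.update ω t r)) t =
      A.play (runLoss ε A ℓ ω) t := fun ω r =>
    A.play_congr fun s hs => runLoss_update A ℓ t ω hs r
  have hint : Integrable (fun ω => A.play (runLoss ε A ℓ ω) t ⬝ᵥ
      (f.lossVec ℓ ω t - f.lossVec ℓ ω t ∘ χ)) f.bitsLaw :=
    integrable_dotProduct_sub_comp (measurable_play_runLoss A ℓ t) (f.measurable_lossVec ℓ t)
      (fun ω => A.play_mem _ t) (fun ω => f.lossVec_mem_Icc ℓ ω t) χ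
  rw [integral_dotProduct_runLoss A ℓ χ t hε (measurable_play_runLoss A ℓ t)
    (fun ω => A.play_mem _ t) hplay]
  calc ∫ ω, f.instSwapRegret ℓ χ t ω ∂f.bitsLaw
      ≤ ∫ ω, (A.play (runLoss ε A ℓ ω) t ⬝ᵥ (f.lossVec ℓ ω t - f.lossVec ℓ ω t ∘ χ) +
          (2 * ε + if t = 0 then 2 else 0)) ∂f.bitsLaw := by
        refine f.integral_instSwapRegret_le ℓ (hint.add (integrable_const _)) fun ω => ?_
        refine (integral_coinAction_sub_comp_le χ (exploitDist_mem (ε : ℝ) A _)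
          (f.lossVec_mem_Icc ℓ ω t)).trans ?_
        split_ifs with ht
        · have hp := (abs_le.1 (abs_dotProduct_sub_comp_le (exploitDist_mem (ε : ℝ) A
            (f.transcript ℓ.loss ω t)) (f.lossVec_mem_Icc ℓ ω t) χ)).2
          have hq := (abs_le.1 (abs_dotProduct_sub_comp_le (A.play_mem (runLoss ε A ℓ ω) t)
            (f.lossVec_mem_Icc ℓ ω t) χ)).1
          linarith
        · rw [exploitDist_transcript A ℓ ht, add_zero]
    _ = _ := by
        rw [integral_add hint (integrable_const _), integral_const, probReal_univ, one_smul]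

lemma monoBandit_swapRegret_le (hε : 0 < ε) {A : FullAlgorithm k} {T : ℕ} {S : ℝ}
    (hS : A.HasSwapRegretLE T S) :
    (monoBandit ε (A.rescale (k / ε))).swapRegret ℓ T ≤ k / ε * S + 2 * ε * T + 2 := by
  have hB : (0 : ℝ) < k / ε :=
    div_pos (by exact_mod_cast Nat.pos_of_ne_zero (NeZero.ne k)) hε
  set A' := A.rescale (k / ε)
  set f := monoBandit ε A'
  rw [f.swapRegret_eq_iSup_integral]
  refine ciSup_le fun χ => ?_
  have hint : ∀ t, Integrable (fun ω => A'.play (runLoss ε A' ℓ ω) t ⬝ᵥ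
      (runLoss ε A' ℓ ω t - runLoss ε A' ℓ ω t ∘ χ)) f.bitsLaw := fun t =>
    integrable_dotProduct_sub_comp (measurable_play_runLoss A' ℓ t) (measurable_runLoss A' ℓ t)
      (fun ω => A'.play_mem _ t) (runLoss_mem_Icc A' ℓ t) χ
  have hfull : ∫ ω, mixedSwapRegret (A'.play (runLoss ε A' ℓ ω)) (runLoss ε A' ℓ ω) T χ
      ∂f.bitsLaw ≤ k / ε * S := by
    refine (integral_mono (integrable_finsetSum _ fun t _ => hint t) (integrable_const _)
      fun ω => hS.mixedSwapRegret_rescale_le hB (fun t => runLoss_mem_Icc A' ℓ t ω) χ).trans_eq ?_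
    rw [integral_const, probReal_univ, one_smul]
  have hfirst : ∑ t ∈ Finset.range T, (if t = 0 then (2 : ℝ) else 0) ≤ 2 := by
    rw [Finset.sum_ite_eq']
    split_ifs <;> norm_num
  calc ∫ ω, ∑ t ∈ Finset.range T, f.instSwapRegret ℓ χ t ω ∂f.bitsLaw
      = ∑ t ∈ Finset.range T, ∫ ω, f.instSwapRegret ℓ χ t ω ∂f.bitsLaw :=
        integral_finsetSum _ fun t _ => f.integrable_instSwapRegret ℓ χ t
    _ ≤ ∑ t ∈ Finset.range T, (∫ ω, A'.play (runLoss ε A' ℓ ω) t ⬝ᵥ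
          (runLoss ε A' ℓ ω t - runLoss ε A' ℓ ω t ∘ χ) ∂f.bitsLaw +
            (2 * ε + if t = 0 then 2 else 0)) :=
        Finset.sum_le_sum fun t _ => integral_instSwapRegret_monoBandit_le A' ℓ χ t hε
    _ = ∫ ω, mixedSwapRegret (A'.play (runLoss ε A' ℓ ω)) (runLoss ε A' ℓ ω) T χ ∂f.bitsLaw +
          (2 * ε * T + ∑ t ∈ Finset.range T, if t = 0 then 2 else 0) := by
        simp only [mixedSwapRegret]
        rw [integral_finsetSum _ fun t _ => hint t, Finset.sum_add_distrib, Finset.sum_add_distrib]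
        simp [mul_comm]
    _ ≤ k / ε * S + 2 * ε * T + 2 := by linarith

end Regret

/-! ### Rates -/

section Rates

open Filter Topology

lemma exists_isLittleO_forall_le_mul {ι α : Type*} {l : Filter α} {w : ι → ℝ} {f : ι → α → ℝ}
    {h : α → ℝ} (hw : ∀ i, 1 ≤ w i) (hw_tendsto : Tendsto w cofinite atTop)
    (hf₀ : ∀ i x, 0 ≤ f i x) (hfh : ∀ i x, f i x ≤ h x) (hf : ∀ i, f i =o[l] h) :
    ∃ g : α → ℝ, g =o[l] h ∧ ∀ i x, f i x ≤ w i * g x := by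
  have hpos : ∀ i, 0 < w i := fun i => one_pos.trans_le (hw i)
  have hquot : ∀ i x, f i x / w i ≤ f i x := fun i x => div_le_self (hf₀ i x) (hw i)
  have hbdd : ∀ x, BddAbove (Set.range fun i => f i x / w i) := fun x =>
    ⟨h x, Set.forall_mem_range.2 fun i => (hquot i x).trans (hfh i x)⟩
  refine ⟨fun x => ⨆ i, f i x / w i, Asymptotics.isLittleO_iff.2 fun η hη => ?_,
    fun i x => (div_le_iff₀' (hpos i)).1 (le_ciSup (hbdd x) i)⟩
  have hfinite : {i | ¬ 1 / η ≤ w i}.Finite := hw_tendsto.eventually_ge_atTop (1 / η)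
  have hsmall : ∀ᶠ x in l, ∀ i ∈ {i | ¬ 1 / η ≤ w i}, ‖f i x‖ ≤ η * ‖h x‖ :=
    hfinite.eventually_all.2 fun i _ => (hf i).bound hη
  filter_upwards [hsmall] with x hx
  have hsup : 0 ≤ ⨆ i, f i x / w i :=
    Real.iSup_nonneg fun i => div_nonneg (hf₀ i x) (hpos i).le
  rw [Real.norm_of_nonneg hsup]
  refine Real.iSup_le (fun i => ?_) (by positivity)
  by_cases hi : 1 / η ≤ w i
  · rw [div_le_iff₀ (hpos i)]
    calc f i x ≤ ‖h x‖ := (hfh i x).trans (le_abs_self _)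
      _ ≤ w i * η * ‖h x‖ := le_mul_of_one_le_left (norm_nonneg _) ((div_le_iff₀ hη).1 hi)
      _ = η * ‖h x‖ * w i := by ring
  · exact (hquot i x).trans ((le_abs_self _).trans (hx i hi))

namespace BanditAlgorithm

variable {k : ℕ} {Ω : Type} [MeasurableSpace Ω] (f : BanditAlgorithm k Ω) (T : ℕ)

/-- The swap regret over `T` rounds against the worst adaptive adversary. -/
noncomputable def worstSwapRegret : ℝ :=
  ⨆ ℓ, f.swapRegret ℓ T

lemma worstSwapRegret_nonneg : 0 ≤ f.worstSwapRegret T :=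
  Real.iSup_nonneg fun ℓ => f.swapRegret_nonneg ℓ T

lemma worstSwapRegret_le [NeZero k] : f.worstSwapRegret T ≤ T :=
  Real.iSup_le (fun ℓ => f.swapRegret_le ℓ T) T.cast_nonneg

lemma swapRegret_le_worstSwapRegret [NeZero k] (ℓ : Adversary k Ω) :
    f.swapRegret ℓ T ≤ f.worstSwapRegret T :=
  le_ciSup (f := fun ℓ => f.swapRegret ℓ T)
    ⟨T, Set.forall_mem_range.2 fun ℓ => f.swapRegret_le ℓ T⟩ ℓ

end BanditAlgorithm

variable {k : ℕ}

/-- The algorithms `A T`, run for `T` rounds, have swap regret `o(T)`. -/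
def NoSwapRegret (A : ℕ → FullAlgorithm k) : Prop :=
  ∃ S : ℕ → ℝ, S =o[atTop] (fun T => (T : ℝ)) ∧ ∀ᶠ T in atTop, (A T).HasSwapRegretLE T (S T)

variable [NeZero k]

lemma treeSwap_noSwapRegret {A : ℕ → FullAlgorithm k} (hA : NoExternalRegret A) {M d : ℕ → ℕ}
    (hpow : ∀ᶠ T in atTop, M T ^ (d T - 1) ≤ T) (hM : Tendsto M atTop atTop)
    (hd : Tendsto d atTop atTop) : NoSwapRegret fun T => treeSwap (A (M T)) (M T) (d T) := by
  obtain ⟨R, hRo, hR⟩ := hA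
  have hrate : Tendsto (fun T => 1 / (d T : ℝ) + 2 * (|R (M T)| / M T)) atTop (𝓝 0) := by
    simpa using (tendsto_one_div_atTop_nhds_zero_nat.comp hd).add
      ((hRo.abs_left.tendsto_div_nhds_zero.comp hM).const_mul 2)
  refine ⟨fun T => (1 / d T + 2 * (|R (M T)| / M T)) * T, ?_, ?_⟩
  · simpa using ((Asymptotics.isLittleO_one_iff ℝ).2 hrate).mul_isBigO
      (Asymptotics.isBigO_refl (fun T : ℕ => (T : ℝ)) atTop)
  · filter_upwards [hpow, hM.eventually_gt_atTop 0, hd.eventually_ge_atTop 1] with T hpowT hMT hdT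
    exact treeSwap_hasSwapRegretLE hMT hdT (abs_nonneg _)
      (fun L hL i => (hR _ L hL i).trans (le_abs_self _)) hpowT

lemma monoBandit_worstSwapRegret_le {A : FullAlgorithm k} {T : ℕ} {δ : ℝ} {ε : unitInterval}
    (hδ : 0 < δ) (hA : A.HasSwapRegretLE T (δ * T)) (hε : (ε : ℝ) = √(k * δ)) :
    (monoBandit ε (A.rescale (k / ε))).worstSwapRegret T ≤ 3 * √(k * δ) * T + 2 := by
  have hk : (0 : ℝ) < k := by exact_mod_cast Nat.pos_of_ne_zero (NeZero.ne k)
  have hsqrt : 0 < √(k * δ) := Real.sqrt_pos.2 (by positivity)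
  have hsq : √(k * δ) ^ 2 = k * δ := Real.sq_sqrt (by positivity)
  have hpos : 0 < ε := by
    rw [← Subtype.coe_lt_coe, hε]
    exact hsqrt
  refine Real.iSup_le (fun ℓ => (monoBandit_swapRegret_le ℓ hpos hA).trans_eq ?_) (by positivity)
  rw [hε]
  have hbalance : k / √(k * δ) * (δ * T) = √(k * δ) * T := by
    field_simp
    rw [hsq]
  rw [hbalance]
  ring

lemma exists_monoBandit_worstSwapRegret_isLittleO {A : ℕ → FullAlgorithm k} (hA : NoSwapRegret A) :
    ∃ ε : ℕ → unitInterval, (∀ T, 0 < ε T) ∧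
      (fun T => (monoBandit (ε T) ((A T).rescale (k / ε T))).worstSwapRegret T) =o[atTop]
        (fun T => (T : ℝ)) := by
  obtain ⟨S, hSo, hS⟩ := hA
  have hk : (0 : ℝ) < k := by exact_mod_cast Nat.pos_of_ne_zero (NeZero.ne k)
  let δ : ℕ → ℝ := fun T => |S T| / T + 1 / (T + 1)
  have hδ : ∀ T, 0 < δ T := fun T => by positivity
  have hSδ : ∀ T, 0 < T → S T ≤ δ T * T := fun T hT => by
    have hT' : (0 : ℝ) < T := by exact_mod_cast hT
    calc S T ≤ |S T| / T * T := by rw [div_mul_cancel₀ _ hT'.ne']; exact le_abs_self _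
      _ ≤ δ T * T := mul_le_mul_of_nonneg_right (le_add_of_nonneg_right (by positivity)) hT'.le
  let e : ℕ → ℝ := fun T => √(k * δ T)
  have he : Tendsto e atTop (𝓝 0) := by
    simpa [e, δ] using ((hSo.abs_left.tendsto_div_nhds_zero.add
      tendsto_one_div_add_atTop_nhds_zero_nat).const_mul (k : ℝ)).sqrt
  have he₀ : ∀ T, 0 < e T := fun T => Real.sqrt_pos.2 (mul_pos hk (hδ T))
  let ε : ℕ → unitInterval := fun T =>
    ⟨min 1 (e T), le_min zero_le_one (he₀ T).le, min_le_left _ _⟩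
  refine ⟨ε, fun T => Subtype.coe_lt_coe.1 (lt_min one_pos (he₀ T)), ?_⟩
  have hbound : (fun T => 3 * e T * (T : ℝ) + 2) =o[atTop] fun T => (T : ℝ) := by
    refine .add ?_ (Asymptotics.isLittleO_const_left.2 (.inr ?_))
    · simpa using ((Asymptotics.isLittleO_one_iff ℝ).2 (by simpa using he.const_mul 3)).mul_isBigO
        (Asymptotics.isBigO_refl (fun T : ℕ => (T : ℝ)) atTop)
    · exact tendsto_norm_atTop_atTop.comp tendsto_natCast_atTop_atTop
  refine Asymptotics.IsBigO.trans_isLittleO (.of_bound' ?_) hbound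
  filter_upwards [hS, eventually_gt_atTop 0, he.eventually_le_const one_pos] with T hST hT heT
  rw [Real.norm_of_nonneg (BanditAlgorithm.worstSwapRegret_nonneg _ T)]
  exact (monoBandit_worstSwapRegret_le (hδ T) (fun L hL χ => (hST L hL χ).trans (hSδ T hT))
    (min_eq_right heT)).trans (le_abs_self _)

lemma one_le_two_mul_sqrt_succ (n : ℕ) : 1 ≤ 2 * √(n + 1 : ℕ) := by
  have hsqrt : 1 ≤ √(n + 1 : ℕ) := Real.one_le_sqrt.2 (by simp)
  linarith

lemma tendsto_two_mul_sqrt_succ : Tendsto (fun n : ℕ => 2 * √(n + 1 : ℕ)) cofinite atTop := by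
  rw [Nat.cofinite_eq_atTop]
  exact (Real.tendsto_sqrt_atTop.comp
    (tendsto_natCast_atTop_atTop.comp (tendsto_add_atTop_nat 1))).const_mul_atTop two_pos

end Rates

-- In the rounds from `M ^ d` on, `treeSwap` runs on fresh copies of its tree.
theorem mainTheorem5_general (Alg : (k : ℕ) → [NeZero k] → ℕ → FullAlgorithm k)
    (M d : ℕ → ℕ → ℕ) :
    ((∀ (k : ℕ) [NeZero k] (N : ℕ), (Alg k N).IsMonotone) →
      ∀ (k : ℕ) [NeZero k] (T : ℕ) (ε : unitInterval), 0 < ε →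
        (monoBanditTreeSwap (Alg k (M k T)) (M k T) (d k T) ε).IsMonotone ∧
        (monoBanditTreeSwap (Alg k (M k T)) (M k T) (d k T) ε).IsLossMonotone) ∧
    ((∀ (k : ℕ) [NeZero k], NoExternalRegret (Alg k)) →
      (∀ (k : ℕ) [NeZero k], ∀ᶠ T in Filter.atTop, M k T ^ (d k T - 1) ≤ T) →
      (∀ (k : ℕ) [NeZero k], Filter.Tendsto (M k) Filter.atTop Filter.atTop) →
      (∀ (k : ℕ) [NeZero k], Filter.Tendsto (d k) Filter.atTop Filter.atTop) →
      ∃ ε : ℕ → ℕ → unitInterval, (∀ k T, 0 < ε k T) ∧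
        ∃ g : ℕ → ℝ, g =o[Filter.atTop] (fun T => (T : ℝ)) ∧
          ∀ (k : ℕ) [NeZero k] (T : ℕ) (ℓ : Adversary k (Coin k × unitInterval)),
            (monoBanditTreeSwap (Alg k (M k T)) (M k T) (d k T) (ε k T)).swapRegret ℓ T ≤
              2 * Real.sqrt k * g T) := by
  refine ⟨fun hmono k _ T ε hε => ?_, fun hreg hpow hM hd => ?_⟩
  · have hA := treeSwap_isMonotone (hmono k (M k T)) (M k T) (d k T)
    exact ⟨monoBandit_isMonotone hε hA, monoBandit_isLossMonotone hε hA⟩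
  · choose ε hε hregret using fun n : ℕ => exists_monoBandit_worstSwapRegret_isLittleO
      (treeSwap_noSwapRegret (hreg (n + 1)) (hpow (n + 1)) (hM (n + 1)) (hd (n + 1)))
    obtain ⟨g, hg, hle⟩ := exists_isLittleO_forall_le_mul one_le_two_mul_sqrt_succ
      tendsto_two_mul_sqrt_succ (fun _ T => BanditAlgorithm.worstSwapRegret_nonneg _ T)
      (fun _ T => BanditAlgorithm.worstSwapRegret_le _ T) hregret
    refine ⟨fun k => ε (k - 1), fun k => hε (k - 1), g, hg, fun k _ T ℓ => ?_⟩
    obtain ⟨n, rfl⟩ := Nat.exists_eq_succ_of_ne_zero (NeZero.ne k)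
    exact (BanditAlgorithm.swapRegret_le_worstSwapRegret _ T ℓ).trans (hle n T)

theorem mainTheorem5 :
    (∀ (Alg : (k : ℕ) → [NeZero k] → ℕ → FullAlgorithm k) (M d : ℕ → ℕ → ℕ),
      (∀ (k : ℕ) [NeZero k] (N : ℕ), (Alg k N).IsMonotone) →
      (∀ (k : ℕ) [NeZero k], NoExternalRegret (Alg k)) →
      IsTreeSwapSchedule M d →
        (∀ (k : ℕ) [NeZero k] (T : ℕ) (ε : unitInterval), 0 < ε →
          (monoBanditTreeSwap (Alg k (M k T)) (M k T) (d k T) ε).IsMonotone ∧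
          (monoBanditTreeSwap (Alg k (M k T)) (M k T) (d k T) ε).IsLossMonotone) ∧
        ∃ ε : ℕ → ℕ → unitInterval, (∀ k T, 0 < ε k T) ∧
          ∃ g : ℕ → ℝ, g =o[Filter.atTop] (fun T => (T : ℝ)) ∧
            ∀ (k : ℕ) [NeZero k] (T : ℕ) (ℓ : Adversary k (Coin k × unitInterval)),
              (monoBanditTreeSwap (Alg k (M k T)) (M k T) (d k T) (ε k T)).swapRegret ℓ T ≤
                2 * Real.sqrt k * g T) ∧
    ((∀ (k : ℕ) [NeZero k] (N : ℕ), (multiplicativeWeights k N).IsMonotone) ∧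
      (∀ (k : ℕ) [NeZero k], NoExternalRegret (multiplicativeWeights k)) ∧
      ∃ M d : ℕ → ℕ → ℕ, IsTreeSwapSchedule M d) := by
  refine ⟨fun Alg M d hmono hreg hsched => ?_, fun k _ N => multiplicativeWeights_isMonotone k N,
    fun k _ => multiplicativeWeights_noExternalRegret k, exists_isTreeSwapSchedule⟩
  obtain ⟨hmonotone, hregret⟩ := mainTheorem5_general Alg M d
  exact ⟨hmonotone hmono, hregret hreg
    (fun k _ => (Filter.eventually_ge_atTop 1).mono (hsched.pow_le k))
    (fun k _ => hsched.tendsto_branching k) (fun k _ => hsched.tendsto_depth k)⟩
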